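/- Let $n\ge 1$ and let $\Omega\subset\mathbb R^n$ be a bounded domain (nonempty connected open set). Let $0<\Gamma_1\le\Gamma_2\le\Gamma_3\le\cdots\to\infty$ be the eigenvalues, repeated according to multiplicity, of the clamped plate problem $$\Delta^2 w=\Gamma w\ \text{ in }\Omega,\qquad w=0=\frac{\partial w}{\partial n}\ \text{ on }\partial\Omega,$$ understood in the weak sense: an eigenfunction is a nonzero real function $w\in H^2_0(\Omega)$ (the closure of $C_c^\infty(\Omega)$ in $H^2(\Omega)$) with $\Delta^2 w=\Gamma w$ in the sense of distributions in $\Omega$. Then for every $m=1,2,3,\ldots$ $$\sum_{i=1}^m\frac{\Gamma_i}{\Gamma_{m+1}-\Gamma_i}\ \ge\ \frac{n^2m}{8(n+2)},$$ where a term with $\Gamma_i=\Gamma_{m+1}$ is read as $+\infty$. -/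

import Mathlib

open MeasureTheory Filter Topology Laplacian
open scoped ENNReal ContDiff Distributions

namespace ClampedPlate

/-- Real `L²(Ω)` with respect to Lebesgue measure on `ℝⁿ`. -/
abbrev L2 {n : ℕ} (Ω : TopologicalSpace.Opens (EuclideanSpace ℝ (Fin n))) : Type :=
  Lp ℝ 2 (volume.restrict (Ω : Set (EuclideanSpace ℝ (Fin n))))

/-- The classical partial derivative `∂f/∂xᵢ`. -/
noncomputable def pderiv {n : ℕ} (i : Fin n) (f : EuclideanSpace ℝ (Fin n) → ℝ) :
    EuclideanSpace ℝ (Fin n) → ℝ :=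
  fun x => fderiv ℝ f x (EuclideanSpace.single i 1)

/-- `g` is the weak partial derivative `∂u/∂xᵢ` of `u` in `Ω`. -/
def IsWeakPDeriv {n : ℕ} (Ω : TopologicalSpace.Opens (EuclideanSpace ℝ (Fin n))) (i : Fin n)
    (u g : L2 Ω) : Prop :=
  ∀ φ : 𝓓(Ω, ℝ),
    ∫ x in (Ω : Set (EuclideanSpace ℝ (Fin n))), u x * pderiv i φ x =
      -∫ x in (Ω : Set (EuclideanSpace ℝ (Fin n))), g x * φ x

/-- `w ∈ H²₀(Ω)`: the function `w ∈ L²(Ω)` has weak first and second partial derivatives in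
`L²(Ω)`, and `w` is the limit in the norm of `H²(Ω)` of a sequence of functions in `C_c^∞(Ω)`. -/
def MemH20 {n : ℕ} (Ω : TopologicalSpace.Opens (EuclideanSpace ℝ (Fin n))) (w : L2 Ω) : Prop :=
  ∃ (g : Fin n → L2 Ω) (h : Fin n → Fin n → L2 Ω),
    (∀ i, IsWeakPDeriv Ω i w (g i)) ∧
    (∀ i j, IsWeakPDeriv Ω j (g i) (h i j)) ∧
    ∃ φ : ℕ → 𝓓(Ω, ℝ),
      Tendsto (fun k => eLpNorm (fun x => w x - φ k x) 2
        (volume.restrict (Ω : Set (EuclideanSpace ℝ (Fin n))))) atTop (𝓝 0) ∧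
      (∀ i, Tendsto (fun k => eLpNorm (fun x => g i x - pderiv i (φ k) x) 2
        (volume.restrict (Ω : Set (EuclideanSpace ℝ (Fin n))))) atTop (𝓝 0)) ∧
      (∀ i j, Tendsto (fun k => eLpNorm (fun x => h i j x - pderiv j (pderiv i (φ k)) x) 2
        (volume.restrict (Ω : Set (EuclideanSpace ℝ (Fin n))))) atTop (𝓝 0))

/-- `Δ²w = Γ w` in `Ω`, in the sense of distributions. -/
def IsBiharmonicSol {n : ℕ} (Ω : TopologicalSpace.Opens (EuclideanSpace ℝ (Fin n))) (Γ : ℝ)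
    (w : L2 Ω) : Prop :=
  ∀ φ : 𝓓(Ω, ℝ),
    ∫ x in (Ω : Set (EuclideanSpace ℝ (Fin n))), w x * (Δ (Δ ⇑φ)) x =
      Γ * ∫ x in (Ω : Set (EuclideanSpace ℝ (Fin n))), w x * φ x

section Helpers

variable {n : ℕ} {Ω : TopologicalSpace.Opens (EuclideanSpace ℝ (Fin n))}

theorem contDiff_pderiv (i : Fin n) {f : EuclideanSpace ℝ (Fin n) → ℝ} (hf : ContDiff ℝ ∞ f) :
    ContDiff ℝ ∞ (pderiv i f) := by
  have h : ContDiff ℝ ∞ (fderiv ℝ f) := hf.fderiv_right (by simp)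
  exact h.clm_apply contDiff_const

theorem hasCompactSupport_pderiv (i : Fin n) {f : EuclideanSpace ℝ (Fin n) → ℝ}
    (hf : HasCompactSupport f) : HasCompactSupport (pderiv i f) :=
  (hf.fderiv ℝ).comp_left (g := fun L : EuclideanSpace ℝ (Fin n) →L[ℝ] ℝ =>
    L (EuclideanSpace.single i 1)) rfl

theorem pderiv_add (i : Fin n) {f g : EuclideanSpace ℝ (Fin n) → ℝ} (hf : ContDiff ℝ ∞ f)
    (hg : ContDiff ℝ ∞ g) : pderiv i (f + g) = pderiv i f + pderiv i g := by
  funext x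
  simp only [pderiv, Pi.add_apply]
  rw [fderiv_add (hf.differentiable (by simp) x) (hg.differentiable (by simp) x)]
  rfl

theorem pderiv_smul (i : Fin n) (c : ℝ) {f : EuclideanSpace ℝ (Fin n) → ℝ}
    (hf : ContDiff ℝ ∞ f) : pderiv i (c • f) = c • pderiv i f := by
  funext x
  simp only [pderiv, Pi.smul_apply]
  rw [fderiv_const_smul (hf.differentiable (by simp) x)]
  rfl

theorem pderiv_zero (i : Fin n) : pderiv i (0 : EuclideanSpace ℝ (Fin n) → ℝ) = 0 := by
  funext x
  simp [pderiv]

theorem laplacian_eq_sum_pderiv {f : EuclideanSpace ℝ (Fin n) → ℝ} (hf : ContDiff ℝ ∞ f) :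
    Δ f = fun x => ∑ i, pderiv i (pderiv i f) x := by
  rw [InnerProductSpace.laplacian_eq_iteratedFDeriv_orthonormalBasis f
    (EuclideanSpace.basisFun (Fin n) ℝ)]
  funext x
  refine Finset.sum_congr rfl fun i _ => ?_
  have h : Differentiable ℝ (fderiv ℝ f) :=
    (hf.fderiv_right (m := ∞) (by simp)).differentiable (by simp)
  rw [iteratedFDeriv_two_apply]
  simp only [pderiv, EuclideanSpace.basisFun_apply, Matrix.cons_val_zero, Matrix.cons_val_one]
  change _ = fderiv ℝ (fun y => (fderiv ℝ f y) (EuclideanSpace.single i 1)) x _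
  rw [fderiv_clm_apply (h x) (differentiableAt_const _)]
  simp

theorem contDiff_laplacian {f : EuclideanSpace ℝ (Fin n) → ℝ} (hf : ContDiff ℝ ∞ f) :
    ContDiff ℝ ∞ (Δ f) := by
  rw [laplacian_eq_sum_pderiv hf]
  exact ContDiff.sum fun i _ => contDiff_pderiv i (contDiff_pderiv i hf)

theorem hasCompactSupport_laplacian {f : EuclideanSpace ℝ (Fin n) → ℝ}
    (hc : HasCompactSupport f) : HasCompactSupport (Δ f) := by
  refine hc.mono' fun x hx => ?_
  by_contra hx'
  apply hx
  have h0 : f =ᶠ[𝓝 x] fun _ => (0 : ℝ) := notMem_tsupport_iff_eventuallyEq.1 hx'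
  have := (InnerProductSpace.laplacian_congr_nhds h0).self_of_nhds
  rw [this]
  simp [InnerProductSpace.laplacian_const]

theorem integrable_mul (u : L2 Ω) {ψ : EuclideanSpace ℝ (Fin n) → ℝ} (hψ : ContDiff ℝ ∞ ψ)
    (hc : HasCompactSupport ψ) :
    Integrable (fun x => u x * ψ x)
      (volume.restrict (Ω : Set (EuclideanSpace ℝ (Fin n)))) :=
  (Lp.memLp u).integrable_mul (q := 2) (hψ.continuous.memLp_of_hasCompactSupport hc)

theorem integral_add_mul (u v : L2 Ω) {ψ : EuclideanSpace ℝ (Fin n) → ℝ} (hψ : ContDiff ℝ ∞ ψ)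
    (hc : HasCompactSupport ψ) :
    ∫ x in (Ω : Set (EuclideanSpace ℝ (Fin n))), (u + v) x * ψ x =
      (∫ x in (Ω : Set (EuclideanSpace ℝ (Fin n))), u x * ψ x) +
        ∫ x in (Ω : Set (EuclideanSpace ℝ (Fin n))), v x * ψ x := by
  rw [← integral_add (integrable_mul u hψ hc) (integrable_mul v hψ hc)]
  refine integral_congr_ae ?_
  filter_upwards [Lp.coeFn_add u v] with x hx
  rw [hx, Pi.add_apply, add_mul]

theorem integral_smul_mul (c : ℝ) (u : L2 Ω) (ψ : EuclideanSpace ℝ (Fin n) → ℝ) :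
    ∫ x in (Ω : Set (EuclideanSpace ℝ (Fin n))), (c • u) x * ψ x =
      c * ∫ x in (Ω : Set (EuclideanSpace ℝ (Fin n))), u x * ψ x := by
  rw [← integral_const_mul]
  refine integral_congr_ae ?_
  filter_upwards [Lp.coeFn_smul c u] with x hx
  rw [hx, Pi.smul_apply, smul_eq_mul, mul_assoc]

theorem IsWeakPDeriv.add {i : Fin n} {u g u' g' : L2 Ω} (h : IsWeakPDeriv Ω i u g)
    (h' : IsWeakPDeriv Ω i u' g') : IsWeakPDeriv Ω i (u + u') (g + g') := by
  intro φ
  rw [integral_add_mul _ _ (contDiff_pderiv i φ.contDiff)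
    (hasCompactSupport_pderiv i φ.hasCompactSupport),
    integral_add_mul _ _ φ.contDiff φ.hasCompactSupport, h φ, h' φ]
  ring

theorem IsWeakPDeriv.smul (c : ℝ) {i : Fin n} {u g : L2 Ω} (h : IsWeakPDeriv Ω i u g) :
    IsWeakPDeriv Ω i (c • u) (c • g) := by
  intro φ
  rw [integral_smul_mul, integral_smul_mul, h φ]
  ring

theorem tendsto_add {u v : L2 Ω} {a b : ℕ → EuclideanSpace ℝ (Fin n) → ℝ}
    (ha : ∀ k, Continuous (a k)) (hb : ∀ k, Continuous (b k))
    (h : Tendsto (fun k => eLpNorm (fun x => u x - a k x) 2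
      (volume.restrict (Ω : Set (EuclideanSpace ℝ (Fin n))))) atTop (𝓝 0))
    (h' : Tendsto (fun k => eLpNorm (fun x => v x - b k x) 2
      (volume.restrict (Ω : Set (EuclideanSpace ℝ (Fin n))))) atTop (𝓝 0)) :
    Tendsto (fun k => eLpNorm (fun x => (u + v) x - (a k + b k) x) 2
      (volume.restrict (Ω : Set (EuclideanSpace ℝ (Fin n))))) atTop (𝓝 0) := by
  have hsum := h.add h'
  rw [add_zero] at hsum
  refine tendsto_of_tendsto_of_tendsto_of_le_of_le tendsto_const_nhds hsum (fun k => bot_le) ?_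
  intro k
  have hu : AEStronglyMeasurable (fun x => u x - a k x)
      (volume.restrict (Ω : Set (EuclideanSpace ℝ (Fin n)))) :=
    (Lp.aestronglyMeasurable u).sub (ha k).aestronglyMeasurable
  have hv : AEStronglyMeasurable (fun x => v x - b k x)
      (volume.restrict (Ω : Set (EuclideanSpace ℝ (Fin n)))) :=
    (Lp.aestronglyMeasurable v).sub (hb k).aestronglyMeasurable
  refine le_trans (le_of_eq (eLpNorm_congr_ae ?_)) (eLpNorm_add_le hu hv (by norm_num))
  filter_upwards [Lp.coeFn_add u v] with x hx
  simp only [hx, Pi.add_apply]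
  ring

theorem tendsto_smul (c : ℝ) {u : L2 Ω} {a : ℕ → EuclideanSpace ℝ (Fin n) → ℝ}
    (h : Tendsto (fun k => eLpNorm (fun x => u x - a k x) 2
      (volume.restrict (Ω : Set (EuclideanSpace ℝ (Fin n))))) atTop (𝓝 0)) :
    Tendsto (fun k => eLpNorm (fun x => (c • u) x - (c • a k) x) 2
      (volume.restrict (Ω : Set (EuclideanSpace ℝ (Fin n))))) atTop (𝓝 0) := by
  have hc := ENNReal.Tendsto.const_mul (a := ‖c‖ₑ) h (Or.inr (by simp))
  rw [mul_zero] at hc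
  refine hc.congr fun k => ?_
  rw [← eLpNorm_const_smul]
  refine eLpNorm_congr_ae ?_
  filter_upwards [Lp.coeFn_smul c u] with x hx
  simp only [hx, Pi.smul_apply, smul_eq_mul]
  ring

theorem MemH20.add {w w' : L2 Ω} (hw : MemH20 Ω w) (hw' : MemH20 Ω w') :
    MemH20 Ω (w + w') := by
  obtain ⟨g, h, hg, hh, φ, h0, h1, h2⟩ := hw
  obtain ⟨g', h', hg', hh', φ', h0', h1', h2'⟩ := hw'
  have e1 : ∀ i k, pderiv i ⇑(φ k + φ' k) = pderiv i (φ k) + pderiv i (φ' k) := fun i k =>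
    pderiv_add i (φ k).contDiff (φ' k).contDiff
  refine ⟨g + g', h + h', fun i => (hg i).add (hg' i), fun i j => (hh i j).add (hh' i j),
    fun k => φ k + φ' k, ?_, fun i => ?_, fun i j => ?_⟩
  · exact tendsto_add (fun k => (φ k).continuous) (fun k => (φ' k).continuous) h0 h0'
  · simp only [e1]
    exact tendsto_add (fun k => (contDiff_pderiv i (φ k).contDiff).continuous)
      (fun k => (contDiff_pderiv i (φ' k).contDiff).continuous) (h1 i) (h1' i)
  · have e2 : ∀ k, pderiv j (pderiv i (φ k) + pderiv i (φ' k)) =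
        pderiv j (pderiv i (φ k)) + pderiv j (pderiv i (φ' k)) := fun k =>
      pderiv_add j (contDiff_pderiv i (φ k).contDiff) (contDiff_pderiv i (φ' k).contDiff)
    simp only [e1, e2]
    exact tendsto_add
      (fun k => (contDiff_pderiv j (contDiff_pderiv i (φ k).contDiff)).continuous)
      (fun k => (contDiff_pderiv j (contDiff_pderiv i (φ' k).contDiff)).continuous)
      (h2 i j) (h2' i j)

theorem MemH20.smul (c : ℝ) {w : L2 Ω} (hw : MemH20 Ω w) : MemH20 Ω (c • w) := by
  obtain ⟨g, h, hg, hh, φ, h0, h1, h2⟩ := hw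
  have e1 : ∀ i k, pderiv i ⇑(c • φ k) = c • pderiv i (φ k) := fun i k =>
    pderiv_smul i c (φ k).contDiff
  refine ⟨c • g, c • h, fun i => (hg i).smul c, fun i j => (hh i j).smul c,
    fun k => c • φ k, ?_, fun i => ?_, fun i j => ?_⟩
  · exact tendsto_smul c h0
  · simp only [e1]
    exact tendsto_smul c (h1 i)
  · have e2 : ∀ k, pderiv j (c • pderiv i (φ k)) = c • pderiv j (pderiv i (φ k)) := fun k =>
      pderiv_smul j c (contDiff_pderiv i (φ k).contDiff)
    simp only [e1, e2]
    exact tendsto_smul c (h2 i j)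

theorem memH20_testFunction (φ : 𝓓(Ω, ℝ)) (w : L2 Ω) (g : Fin n → L2 Ω)
    (h : Fin n → Fin n → L2 Ω)
    (hw : w =ᵐ[volume.restrict (Ω : Set (EuclideanSpace ℝ (Fin n)))] φ)
    (hg : ∀ i, g i =ᵐ[volume.restrict (Ω : Set (EuclideanSpace ℝ (Fin n)))] pderiv i φ)
    (hh : ∀ i j, h i j =ᵐ[volume.restrict (Ω : Set (EuclideanSpace ℝ (Fin n)))]
      pderiv j (pderiv i φ))
    (hg' : ∀ i, IsWeakPDeriv Ω i w (g i)) (hh' : ∀ i j, IsWeakPDeriv Ω j (g i) (h i j)) :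
    MemH20 Ω w := by
  have key : ∀ (u : L2 Ω) (f : EuclideanSpace ℝ (Fin n) → ℝ),
      u =ᵐ[volume.restrict (Ω : Set (EuclideanSpace ℝ (Fin n)))] f →
      eLpNorm (fun x => u x - f x) 2
        (volume.restrict (Ω : Set (EuclideanSpace ℝ (Fin n)))) = 0 := by
    intro u f huf
    rw [eLpNorm_congr_ae (g := 0), eLpNorm_zero]
    filter_upwards [huf] with x hx
    simp [hx]
  refine ⟨g, h, hg', hh', fun _ => φ, ?_, fun i => ?_, fun i j => ?_⟩
  · simp [key _ _ hw]
  · simp [key _ _ (hg i)]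
  · simp [key _ _ (hh i j)]

theorem memH20_zero : MemH20 Ω (0 : L2 Ω) := by
  have z := Lp.coeFn_zero ℝ 2 (volume.restrict (Ω : Set (EuclideanSpace ℝ (Fin n))))
  have hz : ∀ i : Fin n, IsWeakPDeriv Ω i (0 : L2 Ω) 0 := by
    intro i φ
    have a := integral_smul_mul (0 : ℝ) (0 : L2 Ω) (pderiv i φ)
    have b := integral_smul_mul (0 : ℝ) (0 : L2 Ω) φ
    rw [zero_smul, zero_mul] at a b
    rw [a, b, neg_zero]
  have e : ∀ i, pderiv i ⇑(0 : 𝓓(Ω, ℝ)) = 0 := fun i => pderiv_zero i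
  refine memH20_testFunction 0 0 0 0 z (fun i => ?_) (fun i j => ?_) hz (fun _ j => hz j)
  · rw [e]; exact z
  · rw [e, pderiv_zero]; exact z

end Helpers

/-- The space of all `w ∈ H²₀(Ω)` with `Δ²w = Γ w` in `Ω`. Membership in `H²₀(Ω)` expresses the
boundary conditions `w = 0 = ∂w/∂n` on `∂Ω`. A real number `Γ` is an eigenvalue of the clamped
plate problem on `Ω` when this space is nonzero, and its multiplicity is the dimension of it. -/
def eigenspace {n : ℕ} (Ω : TopologicalSpace.Opens (EuclideanSpace ℝ (Fin n))) (Γ : ℝ) :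
    Submodule ℝ (L2 Ω) where
  carrier := {w | MemH20 Ω w ∧ IsBiharmonicSol Ω Γ w}
  zero_mem' := by
    refine ⟨memH20_zero, fun φ => ?_⟩
    have a := integral_smul_mul (0 : ℝ) (0 : L2 Ω)
      (Δ (Δ ⇑φ))
    have b := integral_smul_mul (0 : ℝ) (0 : L2 Ω) φ
    rw [zero_smul, zero_mul] at a b
    rw [a, b, mul_zero]
  add_mem' := by
    rintro u v ⟨hu, hu'⟩ ⟨hv, hv'⟩
    refine ⟨hu.add hv, fun φ => ?_⟩
    rw [integral_add_mul _ _ (contDiff_laplacian (contDiff_laplacian φ.contDiff))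
      (hasCompactSupport_laplacian (hasCompactSupport_laplacian φ.hasCompactSupport)),
      integral_add_mul _ _ φ.contDiff φ.hasCompactSupport, hu' φ, hv' φ, mul_add]
  smul_mem' := by
    rintro c u ⟨hu, hu'⟩
    refine ⟨hu.smul c, fun φ => ?_⟩
    rw [integral_smul_mul, integral_smul_mul, hu' φ]
    ring

/-- The `k`-th eigenvalue `Γ_k` of the clamped plate problem on `Ω` (`k = 1, 2, …`), the eigenvalues
being listed in nondecreasing order and repeated according to multiplicity: the least `μ` such that
the eigenvalues not exceeding `μ` have total multiplicity at least `k`. Eigenspaces of distinct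
eigenvalues being independent, the total multiplicity is the dimension of their sum. -/
noncomputable def eigenvalue {n : ℕ} (Ω : TopologicalSpace.Opens (EuclideanSpace ℝ (Fin n)))
    (k : ℕ) : ℝ :=
  sInf {μ : ℝ | (k : Cardinal) ≤ Module.rank ℝ ↥(⨆ ν ∈ Set.Iic μ, eigenspace Ω ν)}

end ClampedPlate

/-! Write `Energy Ω` for the completion of the test functions under `‖Δ u‖`, `S` for its embedding
`Δ u ↦ u` into `L²(Ω)`, and `T = S S*`. Riesz representation turns the weak eigenvalue problem into
`w = Γ T w`. Here `T` is symmetric, nonnegative, has infinite-dimensional range, and is compact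
because `S` is (`isCompactOperator_energyEmb`). The spectral theorem then makes the counting
definition of `Γ_k` behave as expected: it is finite and positive, and when `Γ_m < Γ_{m+1}` there
are orthonormal eigenfunctions `u_1, …, u_m` with `‖Δ v‖² ≥ Γ_{m+1} ‖v‖²` for every `v` orthogonal
to them (`countingValue_dichotomy`, `eigenvalue_inequality`). When `Γ_m = Γ_{m+1}` the sum is
infinite.

The inequality is a commutator argument (`sum_div_sub_ge`). Let `v_{ip}` be `x_p u_i` minus its
projection to the span of the `u_j`. Since `[Δ, x_p] = 2 ∂_p`, the Rayleigh bound gives `(Γ_{m+1} -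
Γ_i) ‖v_{ip}‖² ≤ 4 ⟪∂_p u_i, Δ v_{ip}⟫` (`trial_le`). Summed over `i`, the projection parts pair a
symmetric matrix with an antisymmetric one and vanish. Summed over `p` as well, a Pohozaev-type
identity bounds the right side by `2 (n + 2) ∑ √Γ_i`. On the other hand `[∂_p, x_p] = 1` gives `-∑_i
⟪v_{ip}, ∂_p u_i⟫ = m / 2` for each `p`. Cauchy–Schwarz with weights `Γ_{m+1} - Γ_i`, together with
`∑_p ‖∂_p u_i‖² ≤ √Γ_i`, yields `(n m / 2)² ≤ 2 (n + 2) (∑ √Γ_i) (∑ √Γ_i / (Γ_{m+1} - Γ_i))`, and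
Chebyshev's sum inequality bounds the product of sums by `m ∑ Γ_i / (Γ_{m+1} - Γ_i)`. -/

namespace ClampedPlate

open scoped InnerProductSpace

/-! ### Commutators and integration by parts on test functions -/

section TestFunctions

variable {n : ℕ} {Ω : TopologicalSpace.Opens (EuclideanSpace ℝ (Fin n))}

theorem tsupport_pderiv_subset (p : Fin n) (f : EuclideanSpace ℝ (Fin n) → ℝ) :
    tsupport (pderiv p f) ⊆ tsupport f := by
  refine (closure_mono fun x hx => ?_).trans (tsupport_fderiv_subset ℝ)
  exact fun h => hx (by simp [pderiv, h])

/-- The partial derivative `∂/∂x_p` on test functions. -/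
noncomputable def testDeriv (p : Fin n) : 𝓓(Ω, ℝ) →ₗ[ℝ] 𝓓(Ω, ℝ) where
  toFun φ := ⟨pderiv p φ, contDiff_pderiv p φ.contDiff,
    hasCompactSupport_pderiv p φ.hasCompactSupport,
    (tsupport_pderiv_subset p φ).trans φ.tsupport_subset⟩
  map_add' φ ψ := DFunLike.coe_injective (pderiv_add p φ.contDiff ψ.contDiff)
  map_smul' c φ := DFunLike.coe_injective (pderiv_smul p c φ.contDiff)

theorem testDeriv_coe (p : Fin n) (φ : 𝓓(Ω, ℝ)) : ⇑(testDeriv p φ) = pderiv p φ := rfl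

/-- Multiplication by the coordinate `x_p` on test functions. -/
noncomputable def coordMul (p : Fin n) : 𝓓(Ω, ℝ) →ₗ[ℝ] 𝓓(Ω, ℝ) where
  toFun φ := ⟨fun x => x p * φ x, (contDiff_euclidean.1 contDiff_id p).mul φ.contDiff,
    φ.hasCompactSupport.mul_left, (tsupport_mul_subset_right).trans φ.tsupport_subset⟩
  map_add' φ ψ := by ext x; exact mul_add _ _ _
  map_smul' c φ := by ext x; exact mul_left_comm _ _ _

theorem coordMul_apply (p : Fin n) (φ : 𝓓(Ω, ℝ)) (x : EuclideanSpace ℝ (Fin n)) :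
    coordMul p φ x = x p * φ x := rfl

theorem memLp_testFunction (φ : 𝓓(Ω, ℝ)) :
    MemLp φ 2 (volume.restrict (Ω : Set (EuclideanSpace ℝ (Fin n)))) :=
  φ.continuous.memLp_of_hasCompactSupport φ.hasCompactSupport

/-- The inclusion of the test functions into `L²(Ω)`. -/
noncomputable def toL2 : 𝓓(Ω, ℝ) →ₗ[ℝ] L2 Ω where
  toFun φ := (memLp_testFunction φ).toLp φ
  map_add' φ ψ := MemLp.toLp_add (memLp_testFunction φ) (memLp_testFunction ψ)
  map_smul' c φ := MemLp.toLp_const_smul c (memLp_testFunction φ)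

theorem coeFn_toL2 (φ : 𝓓(Ω, ℝ)) :
    toL2 φ =ᵐ[volume.restrict (Ω : Set (EuclideanSpace ℝ (Fin n)))] φ :=
  (memLp_testFunction φ).coeFn_toLp

theorem inner_toL2_right (u : L2 Ω) (φ : 𝓓(Ω, ℝ)) :
    ⟪u, toL2 φ⟫_ℝ = ∫ x in (Ω : Set (EuclideanSpace ℝ (Fin n))), u x * φ x := by
  rw [MeasureTheory.L2.inner_def]
  refine integral_congr_ae ?_
  filter_upwards [coeFn_toL2 φ] with x hx
  simp [hx, mul_comm]

theorem inner_toL2_toL2 (φ ψ : 𝓓(Ω, ℝ)) :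
    ⟪toL2 φ, toL2 ψ⟫_ℝ = ∫ x, φ x * ψ x := by
  have h : ∫ x in (Ω : Set (EuclideanSpace ℝ (Fin n))), φ x * ψ x = ∫ x, φ x * ψ x := by
    refine setIntegral_eq_integral_of_forall_compl_eq_zero fun x hx => ?_
    rw [image_eq_zero_of_notMem_tsupport fun h => hx (φ.tsupport_subset h), zero_mul]
  rw [inner_toL2_right, ← h]
  refine integral_congr_ae ?_
  filter_upwards [coeFn_toL2 φ] with x hx
  rw [hx]

theorem norm_toL2_sq (φ : 𝓓(Ω, ℝ)) : ‖toL2 φ‖ ^ 2 = ∫ x, φ x ^ 2 := by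
  rw [← real_inner_self_eq_norm_sq, inner_toL2_toL2]
  simp only [sq]

theorem inner_testDeriv_left (p : Fin n) (φ ψ : 𝓓(Ω, ℝ)) :
    ⟪toL2 (testDeriv p φ), toL2 ψ⟫_ℝ = -⟪toL2 φ, toL2 (testDeriv p ψ)⟫_ℝ := by
  have hint : ∀ a b : 𝓓(Ω, ℝ), Integrable (fun x => a x * b x) := fun a b =>
    (a.continuous.mul b.continuous).integrable_of_hasCompactSupport a.hasCompactSupport.mul_right
  rw [inner_toL2_toL2, inner_toL2_toL2, eq_neg_iff_add_eq_zero, add_comm,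
    ← eq_neg_iff_add_eq_zero]
  exact integral_mul_fderiv_eq_neg_fderiv_mul_of_integrable (hint (testDeriv p φ) ψ)
    (hint φ (testDeriv p ψ)) (hint φ ψ)
    (fun x _ => φ.contDiff.differentiable (by simp) x)
    (fun x _ => ψ.contDiff.differentiable (by simp) x)

theorem inner_coordMul_left (p : Fin n) (φ ψ : 𝓓(Ω, ℝ)) :
    ⟪toL2 (coordMul p φ), toL2 ψ⟫_ℝ = ⟪toL2 φ, toL2 (coordMul p ψ)⟫_ℝ := by
  rw [inner_toL2_toL2, inner_toL2_toL2]
  refine integral_congr_ae (Eventually.of_forall fun x => ?_)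
  simp only [coordMul_apply]
  ring

theorem testDeriv_comm (p q : Fin n) (φ : 𝓓(Ω, ℝ)) :
    testDeriv p (testDeriv q φ) = testDeriv q (testDeriv p φ) := by
  have key : ∀ (a b : Fin n) (x : EuclideanSpace ℝ (Fin n)), testDeriv a (testDeriv b φ) x =
      fderiv ℝ (fderiv ℝ φ) x (EuclideanSpace.single a 1) (EuclideanSpace.single b 1) := by
    intro a b x
    have h : Differentiable ℝ (fderiv ℝ φ) :=
      (φ.contDiff.fderiv_right (m := ∞) (by simp)).differentiable (by simp)
    change fderiv ℝ (fun y => (fderiv ℝ φ y) (EuclideanSpace.single b 1)) x _ = _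
    rw [fderiv_clm_apply (h x) (differentiableAt_const _)]
    simp
  ext x
  rw [key, key]
  exact (φ.contDiff.contDiffAt.isSymmSndFDerivAt (by
    rw [minSmoothness_of_isRCLikeNormedField]
    exact WithTop.coe_le_coe.2 le_top)).eq _ _

theorem testDeriv_coordMul (p q : Fin n) (φ : 𝓓(Ω, ℝ)) :
    testDeriv p (coordMul q φ) = coordMul q (testDeriv p φ) + if p = q then φ else 0 := by
  ext x
  have hq : HasFDerivAt (fun y : EuclideanSpace ℝ (Fin n) => y q)
      (EuclideanSpace.proj q : EuclideanSpace ℝ (Fin n) →L[ℝ] ℝ) x :=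
    (EuclideanSpace.proj q : EuclideanSpace ℝ (Fin n) →L[ℝ] ℝ).hasFDerivAt
  have hφ := (φ.contDiff.differentiable (by simp) x).hasFDerivAt
  have h := (hq.mul hφ).fderiv
  change fderiv ℝ (fun y => y q * φ y) x (EuclideanSpace.single p 1) =
    x q * pderiv p φ x + (if p = q then φ else 0 : 𝓓(Ω, ℝ)) x
  rw [show (fun y => y q * φ y) = ((fun y : EuclideanSpace ℝ (Fin n) => y q) * ⇑φ) from rfl, h]
  rcases eq_or_ne p q with rfl | hpq
  · simp [pderiv]
  · simp [pderiv, hpq, hpq.symm]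

/-- The Laplacian on test functions. -/
noncomputable def testLaplacian : 𝓓(Ω, ℝ) →ₗ[ℝ] 𝓓(Ω, ℝ) :=
  ∑ p, testDeriv p ∘ₗ testDeriv p

theorem testLaplacian_apply (φ : 𝓓(Ω, ℝ)) :
    testLaplacian φ = ∑ p, testDeriv p (testDeriv p φ) := by
  simp [testLaplacian]

theorem testLaplacian_coe (φ : 𝓓(Ω, ℝ)) : ⇑(testLaplacian φ) = Δ ⇑φ := by
  rw [laplacian_eq_sum_pderiv φ.contDiff, testLaplacian_apply]
  funext x
  simp [testDeriv_coe]

theorem testDeriv_testLaplacian (p : Fin n) (φ : 𝓓(Ω, ℝ)) :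
    testDeriv p (testLaplacian φ) = testLaplacian (testDeriv p φ) := by
  simp only [testLaplacian_apply, map_sum]
  refine Finset.sum_congr rfl fun q _ => ?_
  rw [testDeriv_comm p q, testDeriv_comm p q]

/-- The commutator `[Δ, x_p] = 2 ∂_p`, from summing `[∂_q, x_p] = δ_{pq}` twice over. -/
theorem testLaplacian_coordMul (p : Fin n) (φ : 𝓓(Ω, ℝ)) :
    testLaplacian (coordMul p φ) = coordMul p (testLaplacian φ) + (2 : ℝ) • testDeriv p φ := by
  simp only [testLaplacian_apply, testDeriv_coordMul, map_add, map_sum]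
  have : ∀ q, testDeriv q (if q = p then φ else 0) = if q = p then testDeriv p φ else 0 := by
    intro q
    split_ifs with h
    · rw [h]
    · exact map_zero _
  simp only [this, Finset.sum_add_distrib, two_smul]
  have h2 : ∀ q, (if q = p then testDeriv q φ else 0) = if q = p then testDeriv p φ else 0 := by
    intro q
    split_ifs with h
    · rw [h]
    · rfl
  simp [h2, add_assoc]

theorem inner_testLaplacian_left (φ ψ : 𝓓(Ω, ℝ)) :
    ⟪toL2 (testLaplacian φ), toL2 ψ⟫_ℝ = ⟪toL2 φ, toL2 (testLaplacian ψ)⟫_ℝ := by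
  simp only [testLaplacian_apply, map_sum, sum_inner, inner_sum]
  refine Finset.sum_congr rfl fun q _ => ?_
  rw [inner_testDeriv_left, inner_testDeriv_left, neg_neg]

theorem sum_inner_testDeriv (φ ψ : 𝓓(Ω, ℝ)) :
    ∑ p, ⟪toL2 (testDeriv p φ), toL2 (testDeriv p ψ)⟫_ℝ =
      -⟪toL2 φ, toL2 (testLaplacian ψ)⟫_ℝ := by
  simp only [testLaplacian_apply, map_sum, inner_sum, ← Finset.sum_neg_distrib]
  exact Finset.sum_congr rfl fun q _ => inner_testDeriv_left _ _ _

theorem sum_norm_testDeriv_sq_le (φ : 𝓓(Ω, ℝ)) :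
    ∑ p, ‖toL2 (testDeriv p φ)‖ ^ 2 ≤ ‖toL2 φ‖ * ‖toL2 (testLaplacian φ)‖ := by
  simp only [← real_inner_self_eq_norm_sq]
  rw [sum_inner_testDeriv, ← inner_neg_left, ← norm_neg (toL2 φ)]
  exact real_inner_le_norm _ _

/-- Two integrations by parts move all derivatives into Laplacians. Hence `‖Δ φ‖` alone controls the
full Hessian, with no constant and for any `Ω`. -/
theorem sum_norm_testDeriv_testDeriv_sq (φ : 𝓓(Ω, ℝ)) :
    ∑ p, ∑ q, ‖toL2 (testDeriv q (testDeriv p φ))‖ ^ 2 = ‖toL2 (testLaplacian φ)‖ ^ 2 := by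
  simp only [← real_inner_self_eq_norm_sq, sum_inner_testDeriv, ← testDeriv_testLaplacian]
  rw [Finset.sum_neg_distrib, sum_inner_testDeriv, neg_neg, ← inner_testLaplacian_left]

theorem norm_testDeriv_testDeriv_le (p q : Fin n) (φ : 𝓓(Ω, ℝ)) :
    ‖toL2 (testDeriv q (testDeriv p φ))‖ ≤ ‖toL2 (testLaplacian φ)‖ := by
  refine le_of_sq_le_sq ?_ (norm_nonneg _)
  rw [← sum_norm_testDeriv_testDeriv_sq]
  refine le_trans ?_ (Finset.single_le_sum (fun i _ => Finset.sum_nonneg fun j _ => sq_nonneg _)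
    (Finset.mem_univ p))
  exact Finset.single_le_sum (f := fun q => ‖toL2 (testDeriv q (testDeriv p φ))‖ ^ 2)
    (fun j _ => sq_nonneg _) (Finset.mem_univ q)

/-- Two-sided commutation identity behind the antisymmetry of `(u, v) ↦ ∫ ∂_p u Δv`. -/
theorem inner_testDeriv_testLaplacian (p : Fin n) (φ ψ : 𝓓(Ω, ℝ)) :
    ⟪toL2 (testDeriv p φ), toL2 (testLaplacian ψ)⟫_ℝ =
      -⟪toL2 (testDeriv p ψ), toL2 (testLaplacian φ)⟫_ℝ := by
  rw [inner_testDeriv_left, testDeriv_testLaplacian, ← inner_testLaplacian_left, real_inner_comm]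

/-- This is `[∂_p, x_p] = 1` in weak form. With `φ = ψ` it gives both the Poincaré inequality and
the value `m / 2` in the universal inequality. -/
theorem inner_coordMul_testDeriv (p : Fin n) (φ ψ : 𝓓(Ω, ℝ)) :
    ⟪toL2 (coordMul p φ), toL2 (testDeriv p ψ)⟫_ℝ +
      ⟪toL2 (coordMul p ψ), toL2 (testDeriv p φ)⟫_ℝ = -⟪toL2 φ, toL2 ψ⟫_ℝ := by
  have h := inner_testDeriv_left p (coordMul p φ) ψ
  rw [testDeriv_coordMul, if_pos rfl, map_add, inner_add_left, inner_coordMul_left,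
    real_inner_comm] at h
  linarith

/-- The commutator contributes `2 ⟪∂_p φ, Δ ψ⟫ - 2 ⟪Δ φ, ∂_p ψ⟫`; antisymmetry makes the two terms
equal, whence the factor 4. -/
theorem inner_testLaplacian_coordMul (p : Fin n) (φ ψ : 𝓓(Ω, ℝ)) :
    ⟪toL2 (testLaplacian (coordMul p φ)), toL2 (testLaplacian ψ)⟫_ℝ -
      ⟪toL2 (testLaplacian φ), toL2 (testLaplacian (coordMul p ψ))⟫_ℝ =
      4 * ⟪toL2 (testDeriv p φ), toL2 (testLaplacian ψ)⟫_ℝ := by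
  have h := inner_testDeriv_testLaplacian p φ ψ
  rw [real_inner_comm _ (toL2 (testDeriv p ψ))] at h
  simp only [testLaplacian_coordMul, map_add, map_smul, inner_add_left, inner_add_right,
    inner_smul_left, inner_smul_right, inner_coordMul_left]
  simp only [conj_trivial]
  linarith

/-- A Pohozaev-type identity: after moving one `∂_q` across, what remains is `⟪x_p ψ, ∂_p ψ⟫ = -‖ψ‖²
/ 2` for `ψ = ∂_q φ`, plus the commutator term at `q = p`. -/
theorem inner_coordMul_testDeriv_testDeriv (p q : Fin n) (φ : 𝓓(Ω, ℝ)) :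
    ⟪toL2 (coordMul p (testDeriv p φ)), toL2 (testDeriv q (testDeriv q φ))⟫_ℝ =
      2⁻¹ * ‖toL2 (testDeriv q φ)‖ ^ 2 -
        if q = p then ‖toL2 (testDeriv p φ)‖ ^ 2 else 0 := by
  have h1 := inner_testDeriv_left q (coordMul p (testDeriv p φ)) (testDeriv q φ)
  have h2 := inner_coordMul_testDeriv p (testDeriv q φ) (testDeriv q φ)
  rw [testDeriv_coordMul, map_add, inner_add_left, inner_coordMul_left, testDeriv_comm,
    real_inner_comm] at h1
  have h3 : ⟪toL2 (if q = p then testDeriv p φ else 0), toL2 (testDeriv q φ)⟫_ℝ =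
      if q = p then ‖toL2 (testDeriv p φ)‖ ^ 2 else 0 := by
    split_ifs with h
    · rw [h, real_inner_self_eq_norm_sq]
    · simp
  rw [h3] at h1
  rw [real_inner_self_eq_norm_sq] at h2
  linarith

theorem sum_inner_testDeriv_testLaplacian_coordMul (φ : 𝓓(Ω, ℝ)) :
    ∑ p, ⟪toL2 (testDeriv p φ), toL2 (testLaplacian (coordMul p φ))⟫_ℝ =
      (n / 2 + 1) * ∑ p, ‖toL2 (testDeriv p φ)‖ ^ 2 := by
  have h : ∀ p, ⟪toL2 (testDeriv p φ), toL2 (testLaplacian (coordMul p φ))⟫_ℝ =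
      2⁻¹ * (∑ q, ‖toL2 (testDeriv q φ)‖ ^ 2) + ‖toL2 (testDeriv p φ)‖ ^ 2 := by
    intro p
    rw [testLaplacian_coordMul, map_add, map_smul, inner_add_right, inner_smul_right,
      real_inner_self_eq_norm_sq, ← inner_coordMul_left, testLaplacian_apply, map_sum, inner_sum]
    simp only [inner_coordMul_testDeriv_testDeriv, Finset.sum_sub_distrib, ← Finset.mul_sum]
    simp
    ring
  simp only [h, Finset.sum_add_distrib]
  simp
  ring

theorem norm_coordMul_le {R : ℝ} (hR : ∀ x ∈ (Ω : Set (EuclideanSpace ℝ (Fin n))), ‖x‖ ≤ R)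
    (p : Fin n) (φ : 𝓓(Ω, ℝ)) : ‖toL2 (coordMul p φ)‖ ≤ R * ‖toL2 φ‖ := by
  refine Lp.norm_le_mul_norm_of_ae_le_mul ?_
  filter_upwards [coeFn_toL2 φ, coeFn_toL2 (coordMul p φ),
    ae_restrict_mem Ω.isOpen.measurableSet] with x h1 h2 hx
  rw [h1, h2, coordMul_apply, norm_mul]
  exact mul_le_mul_of_nonneg_right ((PiLp.norm_apply_le x p).trans (hR x hx)) (norm_nonneg _)

/-- The Poincaré inequality in one coordinate direction. -/
theorem norm_toL2_le_norm_testDeriv {R : ℝ} (hR0 : 0 ≤ R)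
    (hR : ∀ x ∈ (Ω : Set (EuclideanSpace ℝ (Fin n))), ‖x‖ ≤ R)
    (p : Fin n) (φ : 𝓓(Ω, ℝ)) : ‖toL2 φ‖ ≤ 2 * R * ‖toL2 (testDeriv p φ)‖ := by
  rcases (norm_nonneg (toL2 φ)).eq_or_lt with h0 | h0
  · rw [← h0]; positivity
  have h := inner_coordMul_testDeriv p φ φ
  rw [real_inner_self_eq_norm_sq] at h
  have h1 : -⟪toL2 (coordMul p φ), toL2 (testDeriv p φ)⟫_ℝ ≤
      R * ‖toL2 φ‖ * ‖toL2 (testDeriv p φ)‖ := by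
    refine (neg_le_abs _).trans ((abs_real_inner_le_norm _ _).trans ?_)
    exact mul_le_mul_of_nonneg_right (norm_coordMul_le hR p φ) (norm_nonneg _)
  refine le_of_mul_le_mul_left ?_ h0
  linarith

/-- Combine `‖∂_p φ‖² ≤ ‖φ‖ ‖Δ φ‖` with the Poincaré inequality and cancel one factor `‖∂_p φ‖`. -/
theorem norm_testDeriv_le_norm_testLaplacian {R : ℝ} (hR0 : 0 ≤ R)
    (hR : ∀ x ∈ (Ω : Set (EuclideanSpace ℝ (Fin n))), ‖x‖ ≤ R)
    (p : Fin n) (φ : 𝓓(Ω, ℝ)) :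
    ‖toL2 (testDeriv p φ)‖ ≤ 2 * R * ‖toL2 (testLaplacian φ)‖ := by
  rcases (norm_nonneg (toL2 (testDeriv p φ))).eq_or_lt with h0 | h0
  · rw [← h0]; positivity
  have h1 := norm_toL2_le_norm_testDeriv hR0 hR p φ
  have h2 := (Finset.single_le_sum (f := fun q => ‖toL2 (testDeriv q φ)‖ ^ 2)
    (fun j _ => sq_nonneg _) (Finset.mem_univ p)).trans (sum_norm_testDeriv_sq_le φ)
  have h3 := mul_le_mul_of_nonneg_right h1 (norm_nonneg (toL2 (testLaplacian φ)))
  refine le_of_mul_le_mul_left ?_ h0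
  linarith

end TestFunctions

/-! ### The energy space and the operator form of the eigenvalue problem -/

section Energy

variable {n : ℕ} {Ω : TopologicalSpace.Opens (EuclideanSpace ℝ (Fin n))}

/-- The closure in `L²(Ω)` of the Laplacians of test functions. For bounded `Ω` it is isometric to
`H²₀(Ω)` with the norm `‖Δ u‖`, an element `u` being represented by `Δ u`. -/
noncomputable abbrev Energy (Ω : TopologicalSpace.Opens (EuclideanSpace ℝ (Fin n))) :
    Submodule ℝ (L2 Ω) :=
  (LinearMap.range ((toL2 : 𝓓(Ω, ℝ) →ₗ[ℝ] L2 Ω) ∘ₗ testLaplacian)).topologicalClosure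

instance : CompleteSpace (Energy Ω) :=
  (Submodule.isClosed_topologicalClosure _).completeSpace_coe

/-- The test functions as elements of the energy space. -/
noncomputable def toEnergy : 𝓓(Ω, ℝ) →ₗ[ℝ] Energy Ω :=
  (toL2 ∘ₗ testLaplacian).codRestrict _ fun φ =>
    Submodule.le_topologicalClosure _ (LinearMap.mem_range_self _ φ)

theorem coe_toEnergy (φ : 𝓓(Ω, ℝ)) : (toEnergy φ : L2 Ω) = toL2 (testLaplacian φ) := rfl

theorem norm_toEnergy (φ : 𝓓(Ω, ℝ)) : ‖toEnergy φ‖ = ‖toL2 (testLaplacian φ)‖ := rfl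

theorem denseRange_toEnergy : DenseRange (toEnergy : 𝓓(Ω, ℝ) →ₗ[ℝ] Energy Ω) := by
  rw [DenseRange, Subtype.dense_iff]
  intro x hx
  refine closure_mono ?_ hx
  rintro _ ⟨φ, rfl⟩
  exact ⟨toEnergy φ, ⟨φ, rfl⟩, rfl⟩

/-- Relations between continuous expressions are closed conditions, so each identity above passes
from test functions to the whole energy space by density. -/
theorem energy_induction {P : Energy Ω → Prop} (hP : IsClosed {g | P g})
    (h : ∀ φ : 𝓓(Ω, ℝ), P (toEnergy φ)) (g : Energy Ω) : P g :=
  denseRange_toEnergy.induction_on g hP h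

theorem energy_induction₂ {P : Energy Ω → Energy Ω → Prop}
    (hP : IsClosed {g : Energy Ω × Energy Ω | P g.1 g.2})
    (h : ∀ φ ψ : 𝓓(Ω, ℝ), P (toEnergy φ) (toEnergy ψ)) (f g : Energy Ω) : P f g :=
  denseRange_toEnergy.induction_on₂ hP h f g

/-- The embedding `H²₀(Ω) → L²(Ω)`, `Δ u ↦ u`. -/
noncomputable def energyEmb (Ω : TopologicalSpace.Opens (EuclideanSpace ℝ (Fin n))) :
    Energy Ω →L[ℝ] L2 Ω :=
  LinearMap.extendOfNorm toL2 toEnergy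

/-- The first derivatives on `H²₀(Ω)`, `Δ u ↦ ∂u/∂x_p`. -/
noncomputable def energyDeriv (Ω : TopologicalSpace.Opens (EuclideanSpace ℝ (Fin n)))
    (p : Fin n) : Energy Ω →L[ℝ] L2 Ω :=
  LinearMap.extendOfNorm (toL2 ∘ₗ testDeriv p) toEnergy

/-- The second derivatives on `H²₀(Ω)`, `Δ u ↦ ∂²u/∂x_p∂x_q`. -/
noncomputable def energyDeriv₂ (Ω : TopologicalSpace.Opens (EuclideanSpace ℝ (Fin n)))
    (p q : Fin n) : Energy Ω →L[ℝ] L2 Ω :=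
  LinearMap.extendOfNorm (toL2 ∘ₗ testDeriv q ∘ₗ testDeriv p) toEnergy

/-- Multiplication by a coordinate on `H²₀(Ω)`, `Δ u ↦ Δ (x_p u)`. -/
noncomputable def energyCoordMul (Ω : TopologicalSpace.Opens (EuclideanSpace ℝ (Fin n)))
    (p : Fin n) : Energy Ω →L[ℝ] Energy Ω :=
  LinearMap.extendOfNorm (toEnergy ∘ₗ coordMul p) toEnergy

theorem exists_norm_bound (hbdd : Bornology.IsBounded (Ω : Set (EuclideanSpace ℝ (Fin n)))) :
    ∃ R : ℝ, 0 ≤ R ∧ ∀ x ∈ (Ω : Set (EuclideanSpace ℝ (Fin n))), ‖x‖ ≤ R := by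
  obtain ⟨R, hR⟩ := hbdd.exists_norm_le
  exact ⟨max R 0, le_max_right _ _, fun x hx => (hR x hx).trans (le_max_left _ _)⟩

/-- `extendOfNorm` extends the given map only once a norm bound is known. The bound here chains two
Poincaré-type estimates along coordinate 0, which exists because `1 ≤ n`. -/
theorem energyEmb_toEnergy (hn : 1 ≤ n)
    (hbdd : Bornology.IsBounded (Ω : Set (EuclideanSpace ℝ (Fin n)))) (φ : 𝓓(Ω, ℝ)) :
    energyEmb Ω (toEnergy φ) = toL2 φ := by
  obtain ⟨R, hR0, hR⟩ := exists_norm_bound hbdd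
  refine LinearMap.extendOfNorm_eq denseRange_toEnergy ⟨2 * R * (2 * R), fun ψ => ?_⟩ φ
  rw [mul_assoc]
  exact (norm_toL2_le_norm_testDeriv hR0 hR ⟨0, hn⟩ ψ).trans (mul_le_mul_of_nonneg_left
    (norm_testDeriv_le_norm_testLaplacian hR0 hR ⟨0, hn⟩ ψ) (by positivity))

theorem energyDeriv_toEnergy
    (hbdd : Bornology.IsBounded (Ω : Set (EuclideanSpace ℝ (Fin n)))) (p : Fin n) (φ : 𝓓(Ω, ℝ)) :
    energyDeriv Ω p (toEnergy φ) = toL2 (testDeriv p φ) := by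
  obtain ⟨R, hR0, hR⟩ := exists_norm_bound hbdd
  exact LinearMap.extendOfNorm_eq denseRange_toEnergy
    ⟨2 * R, norm_testDeriv_le_norm_testLaplacian hR0 hR p⟩ φ

theorem energyDeriv₂_toEnergy (p q : Fin n) (φ : 𝓓(Ω, ℝ)) :
    energyDeriv₂ Ω p q (toEnergy φ) = toL2 (testDeriv q (testDeriv p φ)) := by
  refine LinearMap.extendOfNorm_eq denseRange_toEnergy ⟨1, fun ψ => ?_⟩ φ
  rw [one_mul]
  exact norm_testDeriv_testDeriv_le p q ψ

theorem energyCoordMul_toEnergy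
    (hbdd : Bornology.IsBounded (Ω : Set (EuclideanSpace ℝ (Fin n)))) (p : Fin n) (φ : 𝓓(Ω, ℝ)) :
    energyCoordMul Ω p (toEnergy φ) = toEnergy (coordMul p φ) := by
  obtain ⟨R, hR0, hR⟩ := exists_norm_bound hbdd
  refine LinearMap.extendOfNorm_eq denseRange_toEnergy ⟨R + 2 * (2 * R), fun ψ => ?_⟩ φ
  simp only [LinearMap.comp_apply, norm_toEnergy, testLaplacian_coordMul, map_add, map_smul]
  refine (norm_add_le _ _).trans ?_
  rw [norm_smul, add_mul, Real.norm_two, mul_assoc 2 (2 * R)]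
  gcongr
  · exact norm_coordMul_le hR p _
  · exact norm_testDeriv_le_norm_testLaplacian hR0 hR p ψ

theorem inner_energyDeriv_emb (hn : 1 ≤ n)
    (hbdd : Bornology.IsBounded (Ω : Set (EuclideanSpace ℝ (Fin n)))) (p : Fin n)
    (f g : Energy Ω) :
    ⟪energyDeriv Ω p f, energyEmb Ω g⟫_ℝ = -⟪energyEmb Ω f, energyDeriv Ω p g⟫_ℝ := by
  refine energy_induction₂ (P := fun f g => ⟪energyDeriv Ω p f, energyEmb Ω g⟫_ℝ =
    -⟪energyEmb Ω f, energyDeriv Ω p g⟫_ℝ) (isClosed_eq (by fun_prop) (by fun_prop))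
    (fun φ ψ => ?_) f g
  simp only [energyEmb_toEnergy hn hbdd, energyDeriv_toEnergy hbdd]
  exact inner_testDeriv_left p φ ψ

theorem inner_energyDeriv_coe
    (hbdd : Bornology.IsBounded (Ω : Set (EuclideanSpace ℝ (Fin n)))) (p : Fin n)
    (f g : Energy Ω) :
    ⟪energyDeriv Ω p f, (g : L2 Ω)⟫_ℝ = -⟪energyDeriv Ω p g, (f : L2 Ω)⟫_ℝ := by
  refine energy_induction₂ (P := fun f g => ⟪energyDeriv Ω p f, (g : L2 Ω)⟫_ℝ =
    -⟪energyDeriv Ω p g, (f : L2 Ω)⟫_ℝ) (isClosed_eq (by fun_prop) (by fun_prop))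
    (fun φ ψ => ?_) f g
  simp only [energyDeriv_toEnergy hbdd, coe_toEnergy]
  exact inner_testDeriv_testLaplacian p φ ψ

theorem inner_emb_energyCoordMul (hn : 1 ≤ n)
    (hbdd : Bornology.IsBounded (Ω : Set (EuclideanSpace ℝ (Fin n)))) (p : Fin n)
    (f g : Energy Ω) :
    ⟪energyEmb Ω (energyCoordMul Ω p f), energyEmb Ω g⟫_ℝ =
      ⟪energyEmb Ω f, energyEmb Ω (energyCoordMul Ω p g)⟫_ℝ := by
  refine energy_induction₂ (P := fun f g => ⟪energyEmb Ω (energyCoordMul Ω p f), energyEmb Ω g⟫_ℝ =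
      ⟪energyEmb Ω f, energyEmb Ω (energyCoordMul Ω p g)⟫_ℝ)
    (isClosed_eq (by fun_prop) (by fun_prop)) (fun φ ψ => ?_) f g
  simp only [energyCoordMul_toEnergy hbdd, energyEmb_toEnergy hn hbdd]
  exact inner_coordMul_left p φ ψ

theorem inner_energyCoordMul_deriv (hn : 1 ≤ n)
    (hbdd : Bornology.IsBounded (Ω : Set (EuclideanSpace ℝ (Fin n)))) (p : Fin n)
    (f g : Energy Ω) :
    ⟪energyEmb Ω (energyCoordMul Ω p f), energyDeriv Ω p g⟫_ℝ +
      ⟪energyEmb Ω (energyCoordMul Ω p g), energyDeriv Ω p f⟫_ℝ =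
      -⟪energyEmb Ω f, energyEmb Ω g⟫_ℝ := by
  refine energy_induction₂ (P := fun f g => ⟪energyEmb Ω (energyCoordMul Ω p f),
      energyDeriv Ω p g⟫_ℝ + ⟪energyEmb Ω (energyCoordMul Ω p g), energyDeriv Ω p f⟫_ℝ =
      -⟪energyEmb Ω f, energyEmb Ω g⟫_ℝ)
    (isClosed_eq (by fun_prop) (by fun_prop)) (fun φ ψ => ?_) f g
  simp only [energyCoordMul_toEnergy hbdd, energyEmb_toEnergy hn hbdd, energyDeriv_toEnergy hbdd]
  exact inner_coordMul_testDeriv p φ ψ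

theorem inner_energyCoordMul_sub
    (hbdd : Bornology.IsBounded (Ω : Set (EuclideanSpace ℝ (Fin n)))) (p : Fin n)
    (f g : Energy Ω) :
    ⟪energyCoordMul Ω p f, g⟫_ℝ - ⟪f, energyCoordMul Ω p g⟫_ℝ =
      4 * ⟪energyDeriv Ω p f, (g : L2 Ω)⟫_ℝ := by
  refine energy_induction₂ (P := fun f g => ⟪energyCoordMul Ω p f, g⟫_ℝ -
      ⟪f, energyCoordMul Ω p g⟫_ℝ = 4 * ⟪energyDeriv Ω p f, (g : L2 Ω)⟫_ℝ)
    (isClosed_eq (by fun_prop) (by fun_prop)) (fun φ ψ => ?_) f g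
  simp only [energyCoordMul_toEnergy hbdd, energyDeriv_toEnergy hbdd]
  exact inner_testLaplacian_coordMul p φ ψ

theorem sum_inner_energyDeriv_coordMul
    (hbdd : Bornology.IsBounded (Ω : Set (EuclideanSpace ℝ (Fin n)))) (f : Energy Ω) :
    ∑ p, ⟪energyDeriv Ω p f, (energyCoordMul Ω p f : L2 Ω)⟫_ℝ =
      (n / 2 + 1) * ∑ p, ‖energyDeriv Ω p f‖ ^ 2 := by
  refine energy_induction (P := fun f => ∑ p, ⟪energyDeriv Ω p f,
      (energyCoordMul Ω p f : L2 Ω)⟫_ℝ = (n / 2 + 1) * ∑ p, ‖energyDeriv Ω p f‖ ^ 2)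
    (isClosed_eq (by fun_prop) (by fun_prop)) (fun φ => ?_) f
  simp only [energyCoordMul_toEnergy hbdd, energyDeriv_toEnergy hbdd]
  exact sum_inner_testDeriv_testLaplacian_coordMul φ

theorem sum_norm_energyDeriv_sq_le (hn : 1 ≤ n)
    (hbdd : Bornology.IsBounded (Ω : Set (EuclideanSpace ℝ (Fin n)))) (f : Energy Ω) :
    ∑ p, ‖energyDeriv Ω p f‖ ^ 2 ≤ ‖energyEmb Ω f‖ * ‖f‖ := by
  refine energy_induction (P := fun f => ∑ p, ‖energyDeriv Ω p f‖ ^ 2 ≤ ‖energyEmb Ω f‖ * ‖f‖)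
    (isClosed_le (by fun_prop) (by fun_prop)) (fun φ => ?_) f
  simp only [energyEmb_toEnergy hn hbdd, energyDeriv_toEnergy hbdd]
  exact sum_norm_testDeriv_sq_le φ

theorem inner_emb_testLaplacian (hn : 1 ≤ n)
    (hbdd : Bornology.IsBounded (Ω : Set (EuclideanSpace ℝ (Fin n)))) (f : Energy Ω)
    (ψ : 𝓓(Ω, ℝ)) :
    ⟪energyEmb Ω f, toL2 (testLaplacian ψ)⟫_ℝ = ⟪(f : L2 Ω), toL2 ψ⟫_ℝ := by
  refine energy_induction (P := fun f => ⟪energyEmb Ω f, toL2 (testLaplacian ψ)⟫_ℝ =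
      ⟪(f : L2 Ω), toL2 ψ⟫_ℝ) (isClosed_eq (by fun_prop) (by fun_prop)) (fun φ => ?_) f
  rw [energyEmb_toEnergy hn hbdd]
  exact (inner_testLaplacian_left φ ψ).symm

theorem inner_emb_testDeriv (hn : 1 ≤ n)
    (hbdd : Bornology.IsBounded (Ω : Set (EuclideanSpace ℝ (Fin n)))) (p : Fin n) (f : Energy Ω)
    (ψ : 𝓓(Ω, ℝ)) :
    ⟪energyEmb Ω f, toL2 (testDeriv p ψ)⟫_ℝ = -⟪energyDeriv Ω p f, toL2 ψ⟫_ℝ := by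
  refine energy_induction (P := fun f => ⟪energyEmb Ω f, toL2 (testDeriv p ψ)⟫_ℝ =
      -⟪energyDeriv Ω p f, toL2 ψ⟫_ℝ) (isClosed_eq (by fun_prop) (by fun_prop)) (fun φ => ?_) f
  rw [energyEmb_toEnergy hn hbdd, energyDeriv_toEnergy hbdd, inner_testDeriv_left, neg_neg]

theorem inner_energyDeriv_testDeriv
    (hbdd : Bornology.IsBounded (Ω : Set (EuclideanSpace ℝ (Fin n)))) (p q : Fin n)
    (f : Energy Ω) (ψ : 𝓓(Ω, ℝ)) :
    ⟪energyDeriv Ω p f, toL2 (testDeriv q ψ)⟫_ℝ = -⟪energyDeriv₂ Ω p q f, toL2 ψ⟫_ℝ := by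
  refine energy_induction (P := fun f => ⟪energyDeriv Ω p f, toL2 (testDeriv q ψ)⟫_ℝ =
      -⟪energyDeriv₂ Ω p q f, toL2 ψ⟫_ℝ) (isClosed_eq (by fun_prop) (by fun_prop))
      (fun φ => ?_) f
  rw [energyDeriv_toEnergy hbdd, energyDeriv₂_toEnergy, inner_testDeriv_left q, neg_neg]

theorem tendsto_eLpNorm_sub_iff (u : L2 Ω) (φ : ℕ → 𝓓(Ω, ℝ)) :
    Tendsto (fun k => eLpNorm (fun x => u x - φ k x) 2
      (volume.restrict (Ω : Set (EuclideanSpace ℝ (Fin n))))) atTop (𝓝 0) ↔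
      Tendsto (fun k => toL2 (φ k)) atTop (𝓝 u) := by
  rw [tendsto_iff_edist_tendsto_0]
  refine tendsto_congr fun k => ?_
  rw [edist_comm, Lp.edist_def]
  refine eLpNorm_congr_ae ?_
  filter_upwards [coeFn_toL2 (φ k)] with x hx
  simp [hx]

theorem isWeakPDeriv_iff (p : Fin n) (u g : L2 Ω) :
    IsWeakPDeriv Ω p u g ↔
      ∀ φ : 𝓓(Ω, ℝ), ⟪u, toL2 (testDeriv p φ)⟫_ℝ = -⟪g, toL2 φ⟫_ℝ := by
  simp only [IsWeakPDeriv, inner_toL2_right]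
  rfl

theorem isBiharmonicSol_iff (Γ : ℝ) (w : L2 Ω) :
    IsBiharmonicSol Ω Γ w ↔
      ∀ φ : 𝓓(Ω, ℝ), ⟪w, toL2 (testLaplacian (testLaplacian φ))⟫_ℝ = Γ * ⟪w, toL2 φ⟫_ℝ := by
  simp only [IsBiharmonicSol, inner_toL2_right, testLaplacian_coe]

/-- Convergence of the second derivatives forces convergence of the Laplacians, hence in the energy
norm. Conversely, energy convergence controls the function and all its first and second derivatives
through the bounded maps `energyEmb`, `energyDeriv`, `energyDeriv₂`. -/
theorem memH20_iff (hn : 1 ≤ n)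
    (hbdd : Bornology.IsBounded (Ω : Set (EuclideanSpace ℝ (Fin n)))) (w : L2 Ω) :
    MemH20 Ω w ↔ ∃ f : Energy Ω, energyEmb Ω f = w := by
  constructor
  · rintro ⟨g, h, -, -, φ, h0, -, h2⟩
    rw [tendsto_eLpNorm_sub_iff] at h0
    have h2' : ∀ i j, Tendsto (fun k => toL2 (testDeriv j (testDeriv i (φ k)))) atTop
        (𝓝 (h i j)) := fun i j => (tendsto_eLpNorm_sub_iff _ _).1 (h2 i j)
    have hlap : Tendsto (fun k => (toEnergy (φ k) : L2 Ω)) atTop (𝓝 (∑ i, h i i)) := by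
      simp only [coe_toEnergy, testLaplacian_apply, map_sum]
      exact tendsto_finsetSum _ fun i _ => h2' i i
    have hmem : ∑ i, h i i ∈ Energy Ω :=
      (Submodule.isClosed_topologicalClosure _).mem_of_tendsto hlap
        (Eventually.of_forall fun k => (toEnergy (φ k)).2)
    have hE : Tendsto (fun k => toEnergy (φ k)) atTop (𝓝 (⟨∑ i, h i i, hmem⟩ : Energy Ω)) :=
      tendsto_subtype_rng.2 hlap
    refine ⟨⟨∑ i, h i i, hmem⟩, tendsto_nhds_unique ?_ h0⟩
    have := ((energyEmb Ω).continuous.tendsto _).comp hE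
    simpa only [Function.comp_def, energyEmb_toEnergy hn hbdd] using this
  · rintro ⟨f, rfl⟩
    obtain ⟨v, hv, hlim⟩ := mem_closure_iff_seq_limit.1 (denseRange_toEnergy (Ω := Ω) f)
    choose φ hφ using hv
    obtain rfl : (fun k => toEnergy (φ k)) = v := funext hφ
    refine ⟨fun i => energyDeriv Ω i f, fun i j => energyDeriv₂ Ω i j f,
      fun i => (isWeakPDeriv_iff _ _ _).2 fun ψ => inner_emb_testDeriv hn hbdd i f ψ,
      fun i j => (isWeakPDeriv_iff _ _ _).2 fun ψ => inner_energyDeriv_testDeriv hbdd i j f ψ,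
      φ, ?_, fun i => ?_, fun i j => ?_⟩
    · rw [tendsto_eLpNorm_sub_iff]
      have := ((energyEmb Ω).continuous.tendsto _).comp hlim
      simpa only [Function.comp_def, energyEmb_toEnergy hn hbdd] using this
    · refine (tendsto_eLpNorm_sub_iff _ (fun k => testDeriv i (φ k))).2 ?_
      have := ((energyDeriv Ω i).continuous.tendsto _).comp hlim
      simpa only [Function.comp_def, energyDeriv_toEnergy hbdd] using this
    · refine (tendsto_eLpNorm_sub_iff _ (fun k => testDeriv j (testDeriv i (φ k)))).2 ?_
      have := ((energyDeriv₂ Ω i j).continuous.tendsto _).comp hlim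
      simpa only [Function.comp_def, energyDeriv₂_toEnergy] using this

-- For `w = S f`, testing the distributional equation says that `f` and `Γ S* S f` have the same
-- inner product with every test function, so they agree by density. Conversely `w = Γ S S* w`
-- already places `w` in the range of `S`, that is, in `H²₀(Ω)`.
open ContinuousLinearMap in
theorem mem_eigenspace_iff (hn : 1 ≤ n)
    (hbdd : Bornology.IsBounded (Ω : Set (EuclideanSpace ℝ (Fin n)))) (Γ : ℝ) (w : L2 Ω) :
    w ∈ eigenspace Ω Γ ↔ w = Γ • energyEmb Ω (adjoint (energyEmb Ω) w) := by
  have key : ∀ f : Energy Ω, IsBiharmonicSol Ω Γ (energyEmb Ω f) ↔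
      f = Γ • adjoint (energyEmb Ω) (energyEmb Ω f) := by
    intro f
    have h1 : ∀ φ : 𝓓(Ω, ℝ), ⟪f, toEnergy φ⟫_ℝ =
        ⟪energyEmb Ω f, toL2 (testLaplacian (testLaplacian φ))⟫_ℝ := fun φ =>
      (inner_emb_testLaplacian hn hbdd f (testLaplacian φ)).symm
    have h2 : ∀ φ : 𝓓(Ω, ℝ), ⟪Γ • adjoint (energyEmb Ω) (energyEmb Ω f), toEnergy φ⟫_ℝ =
        Γ * ⟪energyEmb Ω f, toL2 φ⟫_ℝ := by
      intro φ
      refine (real_inner_smul_left (adjoint (energyEmb Ω) (energyEmb Ω f))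
        (toEnergy φ) Γ).trans ?_
      rw [adjoint_inner_left, energyEmb_toEnergy hn hbdd]
    rw [isBiharmonicSol_iff]
    simp only [← h1, ← h2]
    refine ⟨fun h => denseRange_toEnergy.eq_of_inner_left (𝕜 := ℝ) ?_, fun h φ => by rw [← h]⟩
    exact h
  change MemH20 Ω w ∧ IsBiharmonicSol Ω Γ w ↔ _
  rw [memH20_iff hn hbdd]
  constructor
  · rintro ⟨⟨f, rfl⟩, h⟩
    conv_lhs => rw [(key f).1 h, map_smul]
  · intro h
    have hw : energyEmb Ω (Γ • adjoint (energyEmb Ω) w) = w := by rw [map_smul, ← h]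
    refine ⟨⟨_, hw⟩, ?_⟩
    rw [← hw, key, hw]

end Energy

/-! ### The commutator inequality for trial functions -/

section UniversalInequality

variable {n : ℕ} {Ω : TopologicalSpace.Opens (EuclideanSpace ℝ (Fin n))}

theorem sum_sum_eq_zero_of_antisymm {ι : Type*} [Fintype ι] {f : ι → ι → ℝ}
    (h : ∀ i j, f i j = -f j i) : ∑ i, ∑ j, f i j = 0 := by
  have h1 : ∑ i, ∑ j, f i j = -∑ i, ∑ j, f i j := by
    conv_lhs => rw [Finset.sum_comm]
    simp only [← Finset.sum_neg_distrib]
    exact Finset.sum_congr rfl fun i _ => Finset.sum_congr rfl fun j _ => h j i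
  linarith

/-- The trial functions: `x_p u_i` minus its orthogonal projection to the span of all `u_j`. -/
noncomputable def trial {m : ℕ} (u : Fin m → Energy Ω) (p : Fin n) (i : Fin m) : Energy Ω :=
  energyCoordMul Ω p (u i) -
    ∑ j, ⟪energyEmb Ω (energyCoordMul Ω p (u i)), energyEmb Ω (u j)⟫_ℝ • u j

variable {m : ℕ} {u : Fin m → Energy Ω}

theorem inner_emb_trial (horth : Orthonormal ℝ fun i => energyEmb Ω (u i)) (p : Fin n)
    (i k : Fin m) : ⟪energyEmb Ω (u k), energyEmb Ω (trial u p i)⟫_ℝ = 0 := by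
  rw [trial, map_sub, map_sum, inner_sub_right, inner_sum]
  simp only [map_smul, inner_smul_right]
  rw [Finset.sum_eq_single k]
  · rw [real_inner_self_eq_norm_sq, horth.1 k, real_inner_comm]
    ring
  · intro j _ hj
    rw [horth.2 hj.symm, mul_zero]
  · simp

theorem inner_coord_symm (hn : 1 ≤ n)
    (hbdd : Bornology.IsBounded (Ω : Set (EuclideanSpace ℝ (Fin n)))) (p : Fin n) (i j : Fin m) :
    ⟪energyEmb Ω (energyCoordMul Ω p (u i)), energyEmb Ω (u j)⟫_ℝ =
      ⟪energyEmb Ω (energyCoordMul Ω p (u j)), energyEmb Ω (u i)⟫_ℝ := by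
  rw [inner_emb_energyCoordMul hn hbdd, real_inner_comm]

/-- The projection coefficients are symmetric in `i, j`, while `⟪∂_p u_i, Δ u_j⟫` is antisymmetric,
so the projections drop out after summation over `i`. -/
theorem sum_inner_deriv_trial (hn : 1 ≤ n)
    (hbdd : Bornology.IsBounded (Ω : Set (EuclideanSpace ℝ (Fin n)))) (p : Fin n) :
    ∑ i, ⟪energyDeriv Ω p (u i), (trial u p i : L2 Ω)⟫_ℝ =
      ∑ i, ⟪energyDeriv Ω p (u i), (energyCoordMul Ω p (u i) : L2 Ω)⟫_ℝ := by
  have h0 : ∑ i, ∑ j, ⟪energyEmb Ω (energyCoordMul Ω p (u i)), energyEmb Ω (u j)⟫_ℝ *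
      ⟪energyDeriv Ω p (u i), (u j : L2 Ω)⟫_ℝ = 0 := by
    refine sum_sum_eq_zero_of_antisymm fun i j => ?_
    rw [inner_coord_symm hn hbdd, inner_energyDeriv_coe hbdd, mul_neg]
  rw [← sub_zero (∑ i, ⟪energyDeriv Ω p (u i), (energyCoordMul Ω p (u i) : L2 Ω)⟫_ℝ), ← h0,
    ← Finset.sum_sub_distrib]
  refine Finset.sum_congr rfl fun i _ => ?_
  simp only [trial, Submodule.coe_sub, Submodule.coe_sum, Submodule.coe_smul, inner_sub_right,
    inner_sum, inner_smul_right]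

/-- The same cancellation, now against the antisymmetric `⟪u_j, ∂_p u_i⟫`; each unprojected term
equals `-‖u_i‖² / 2 = -1 / 2`. -/
theorem sum_inner_emb_trial_deriv (hn : 1 ≤ n)
    (hbdd : Bornology.IsBounded (Ω : Set (EuclideanSpace ℝ (Fin n))))
    (horth : Orthonormal ℝ fun i => energyEmb Ω (u i)) (p : Fin n) :
    ∑ i, ⟪energyEmb Ω (trial u p i), energyDeriv Ω p (u i)⟫_ℝ = -(m / 2) := by
  have h0 : ∑ i, ∑ j, ⟪energyEmb Ω (energyCoordMul Ω p (u i)), energyEmb Ω (u j)⟫_ℝ *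
      ⟪energyEmb Ω (u j), energyDeriv Ω p (u i)⟫_ℝ = 0 := by
    refine sum_sum_eq_zero_of_antisymm fun i j => ?_
    rw [inner_coord_symm hn hbdd, ← neg_eq_iff_eq_neg.2 (inner_energyDeriv_emb hn hbdd p _ _),
      real_inner_comm (energyEmb Ω (u i)) (energyDeriv Ω p (u j)), mul_neg]
  have h1 : ∀ i, ⟪energyEmb Ω (trial u p i), energyDeriv Ω p (u i)⟫_ℝ = -(1 / 2) -
      ∑ j, ⟪energyEmb Ω (energyCoordMul Ω p (u i)), energyEmb Ω (u j)⟫_ℝ *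
        ⟪energyEmb Ω (u j), energyDeriv Ω p (u i)⟫_ℝ := by
    intro i
    have h := inner_energyCoordMul_deriv hn hbdd p (u i) (u i)
    rw [real_inner_self_eq_norm_sq, horth.1 i] at h
    simp only [trial, map_sub, map_sum, map_smul, inner_sub_left, sum_inner, real_inner_smul_left]
    linarith
  simp only [h1, Finset.sum_sub_distrib, h0]
  simp
  ring

/-- Since `v` is orthogonal to all `u_j` in both inner products, `‖Δ v‖² = ⟪Δ (x_p u_i), Δ v⟫`.
Moving `x_p` across costs `4 ⟪∂_p u_i, Δ v⟫` and leaves `Γ_i ⟪u_i, x_p v⟫ = Γ_i ‖v‖²`. The Rayleigh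
bound `hray` finishes. -/
theorem trial_le (hn : 1 ≤ n)
    (hbdd : Bornology.IsBounded (Ω : Set (EuclideanSpace ℝ (Fin n)))) {Γ : Fin m → ℝ} {G : ℝ}
    (hu : ∀ i v, ⟪u i, v⟫_ℝ = Γ i * ⟪energyEmb Ω (u i), energyEmb Ω v⟫_ℝ)
    (horth : Orthonormal ℝ fun i => energyEmb Ω (u i))
    (hray : ∀ v, (∀ i, ⟪energyEmb Ω (u i), energyEmb Ω v⟫_ℝ = 0) →
      G * ‖energyEmb Ω v‖ ^ 2 ≤ ‖v‖ ^ 2) (p : Fin n) (i : Fin m) :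
    (G - Γ i) * ‖energyEmb Ω (trial u p i)‖ ^ 2 ≤
      4 * ⟪energyDeriv Ω p (u i), (trial u p i : L2 Ω)⟫_ℝ := by
  set v := trial u p i with hv
  have h0 : ∀ k, ⟪energyEmb Ω (u k), energyEmb Ω v⟫_ℝ = 0 := inner_emb_trial horth p i
  have h0' : ∀ k, ⟪u k, v⟫_ℝ = 0 := fun k => by rw [hu, h0, mul_zero]
  have hM : energyCoordMul Ω p (u i) = v +
      ∑ j, ⟪energyEmb Ω (energyCoordMul Ω p (u i)), energyEmb Ω (u j)⟫_ℝ • u j := by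
    rw [hv, trial, sub_add_cancel]
  have h1 : ⟪energyCoordMul Ω p (u i), v⟫_ℝ = ‖v‖ ^ 2 := by
    rw [hM, inner_add_left, sum_inner, real_inner_self_eq_norm_sq]
    refine add_eq_left.2 (Finset.sum_eq_zero fun j _ => ?_)
    exact (real_inner_smul_left (u j) v _).trans (by rw [h0', mul_zero])
  have h2 : ⟪energyEmb Ω (energyCoordMul Ω p (u i)), energyEmb Ω v⟫_ℝ =
      ‖energyEmb Ω v‖ ^ 2 := by
    rw [hM, map_add, map_sum, inner_add_left, sum_inner, real_inner_self_eq_norm_sq]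
    simp only [map_smul, real_inner_smul_left, h0, mul_zero, Finset.sum_const_zero, add_zero]
  have h3 := inner_energyCoordMul_sub hbdd p (u i) v
  rw [h1, hu, ← inner_emb_energyCoordMul hn hbdd, h2] at h3
  have := hray v h0
  linarith

/-- The universal inequality for clamped plate eigenvalues, for a finite family of eigenfunctions
satisfying a variational lower bound on its orthogonal complement. -/
theorem sum_div_sub_ge (hn : 1 ≤ n)
    (hbdd : Bornology.IsBounded (Ω : Set (EuclideanSpace ℝ (Fin n)))) {Γ : Fin m → ℝ} {G : ℝ}
    (hm : 1 ≤ m) (hpos : ∀ i, 0 < Γ i) (hmono : Monotone Γ) (hlt : ∀ i, Γ i < G)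
    (hu : ∀ i v, ⟪u i, v⟫_ℝ = Γ i * ⟪energyEmb Ω (u i), energyEmb Ω v⟫_ℝ)
    (horth : Orthonormal ℝ fun i => energyEmb Ω (u i))
    (hray : ∀ v, (∀ i, ⟪energyEmb Ω (u i), energyEmb Ω v⟫_ℝ = 0) →
      G * ‖energyEmb Ω v‖ ^ 2 ≤ ‖v‖ ^ 2) :
    (n : ℝ) ^ 2 * m / (8 * (n + 2)) ≤ ∑ i, Γ i / (G - Γ i) := by
  have hG : ∀ i, 0 < G - Γ i := fun i => sub_pos.2 (hlt i)
  have hnorm : ∀ i, ‖u i‖ = √(Γ i) := by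
    intro i
    rw [← Real.sqrt_sq (norm_nonneg (u i)), ← real_inner_self_eq_norm_sq, hu,
      real_inner_self_eq_norm_sq, horth.1 i]
    simp
  have hderiv : ∀ i, ∑ p, ‖energyDeriv Ω p (u i)‖ ^ 2 ≤ √(Γ i) := by
    intro i
    have := sum_norm_energyDeriv_sq_le hn hbdd (u i)
    rwa [horth.1 i, one_mul, hnorm] at this
  set x : Fin m → Fin n → ℝ := fun i p => ‖energyEmb Ω (trial u p i)‖
  set y : Fin m → Fin n → ℝ := fun i p => ‖energyDeriv Ω p (u i)‖
  -- The constant is `4 (n / 2 + 1)`.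
  have hA : ∑ i, ∑ p, (G - Γ i) * x i p ^ 2 ≤ 2 * (n + 2) * ∑ i, √(Γ i) := by
    calc ∑ i, ∑ p, (G - Γ i) * x i p ^ 2
        ≤ ∑ i, ∑ p, 4 * ⟪energyDeriv Ω p (u i), (trial u p i : L2 Ω)⟫_ℝ :=
          Finset.sum_le_sum fun i _ => Finset.sum_le_sum fun p _ =>
            trial_le hn hbdd hu horth hray p i
      _ = ∑ i, 4 * ∑ p, ⟪energyDeriv Ω p (u i), (energyCoordMul Ω p (u i) : L2 Ω)⟫_ℝ := by
          rw [Finset.sum_comm]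
          simp only [← Finset.mul_sum, sum_inner_deriv_trial hn hbdd]
          rw [Finset.sum_comm]
      _ = ∑ i, 2 * (n + 2) * ∑ p, ‖energyDeriv Ω p (u i)‖ ^ 2 := by
          refine Finset.sum_congr rfl fun i _ => ?_
          rw [sum_inner_energyDeriv_coordMul hbdd]
          ring
      _ ≤ 2 * (n + 2) * ∑ i, √(Γ i) := by
          rw [← Finset.mul_sum]
          gcongr with i
          exact hderiv i
  have hB : ∑ i, ∑ p, y i p ^ 2 / (G - Γ i) ≤ ∑ i, √(Γ i) / (G - Γ i) := by
    refine Finset.sum_le_sum fun i _ => ?_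
    rw [← Finset.sum_div]
    exact div_le_div_of_nonneg_right (hderiv i) (hG i).le
  have hC : (n : ℝ) * m / 2 ≤ ∑ i, ∑ p, x i p * y i p := by
    rw [Finset.sum_comm]
    have : ∀ p : Fin n, (m : ℝ) / 2 ≤ ∑ i, x i p * y i p := by
      intro p
      rw [← neg_neg ((m : ℝ) / 2), ← sum_inner_emb_trial_deriv hn hbdd horth p,
        ← Finset.sum_neg_distrib]
      exact Finset.sum_le_sum fun i _ => (neg_le_abs _).trans (abs_real_inner_le_norm _ _)
    refine le_trans (le_of_eq ?_) (Finset.sum_le_sum fun p _ => this p)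
    simp
    ring
  -- Cauchy–Schwarz over the pairs `(i, p)`, with weight `G - Γ i` on one factor and its inverse on
  -- the other.
  have hCS : (∑ i, ∑ p, x i p * y i p) ^ 2 ≤
      (∑ i, ∑ p, (G - Γ i) * x i p ^ 2) * ∑ i, ∑ p, y i p ^ 2 / (G - Γ i) := by
    simp only [← Finset.sum_product']
    refine Finset.sum_sq_le_sum_mul_sum_of_sq_le_mul _ (fun a _ => ?_) (fun a _ => ?_)
      (fun a _ => ?_)
    · exact mul_nonneg (hG _).le (sq_nonneg _)
    · exact div_nonneg (sq_nonneg _) (hG _).le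
    · have := (hG a.1).ne'
      refine le_of_eq ?_
      field_simp
  -- Chebyshev's sum inequality: `√Γ_i` and `√Γ_i / (G - Γ_i)` increase together.
  have hCh : (∑ i, √(Γ i)) * ∑ i, √(Γ i) / (G - Γ i) ≤ m * ∑ i, Γ i / (G - Γ i) := by
    have hmv : Monovary (fun i => √(Γ i)) fun i => √(Γ i) / (G - Γ i) := by
      refine Monotone.monovary (fun i j hij => Real.sqrt_le_sqrt (hmono hij)) fun i j hij => ?_
      exact div_le_div₀ (Real.sqrt_nonneg _) (Real.sqrt_le_sqrt (hmono hij)) (hG j)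
        (sub_le_sub_left (hmono hij) G)
    have := hmv.sum_mul_sum_le_card_mul_sum
    rw [Fintype.card_fin] at this
    refine this.trans (le_of_eq ?_)
    congr 1
    refine Finset.sum_congr rfl fun i _ => ?_
    rw [← mul_div_assoc, Real.mul_self_sqrt (hpos i).le]
  have hfin : ((n : ℝ) * m / 2) ^ 2 ≤ 2 * (n + 2) * (m * ∑ i, Γ i / (G - Γ i)) := by
    calc ((n : ℝ) * m / 2) ^ 2 ≤ (∑ i, ∑ p, x i p * y i p) ^ 2 := by gcongr
      _ ≤ _ := hCS
      _ ≤ (2 * (n + 2) * ∑ i, √(Γ i)) * ∑ i, √(Γ i) / (G - Γ i) := by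
          refine mul_le_mul hA hB ?_ (by positivity)
          exact Finset.sum_nonneg fun i _ => Finset.sum_nonneg fun p _ =>
            div_nonneg (sq_nonneg _) (hG i).le
      _ ≤ _ := by
          rw [mul_assoc]
          gcongr
  have hm' : (0 : ℝ) < m := by exact_mod_cast hm
  rw [div_le_iff₀ (by positivity)]
  refine le_of_mul_le_mul_left ?_ hm'
  linarith

end UniversalInequality

/-! ### Counting eigenvalues of a compact nonnegative operator -/

section Counting

variable {L : Type*} [NormedAddCommGroup L] [InnerProductSpace ℝ L]

/-- The sum of the spaces `E ν` with `ν ≤ μ`. -/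
def lowSpan (E : ℝ → Submodule ℝ L) (μ : ℝ) : Submodule ℝ L := ⨆ ν ∈ Set.Iic μ, E ν

/-- The `k`-th value of the parameter, counted with the dimensions of the spaces `E ν`. -/
noncomputable def countingValue (E : ℝ → Submodule ℝ L) (k : ℕ) : ℝ :=
  sInf {μ : ℝ | (k : Cardinal) ≤ Module.rank ℝ (lowSpan E μ)}

theorem le_lowSpan (E : ℝ → Submodule ℝ L) {ν μ : ℝ} (h : ν ≤ μ) : E ν ≤ lowSpan E μ :=
  le_iSup₂_of_le ν h le_rfl

theorem lowSpan_le_iff {E : ℝ → Submodule ℝ L} {μ : ℝ} {V : Submodule ℝ L} :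
    lowSpan E μ ≤ V ↔ ∀ ν ≤ μ, E ν ≤ V := by
  simp [lowSpan]

theorem lowSpan_mono (E : ℝ → Submodule ℝ L) : Monotone (lowSpan E) := fun _ _ h =>
  lowSpan_le_iff.2 fun _ hν => le_lowSpan E (hν.trans h)

variable {E : ℝ → Submodule ℝ L} {T : L →L[ℝ] L}

theorem mem_of_apply_eq (hE : ∀ Γ w, w ∈ E Γ ↔ w = Γ • T w) {c : ℝ} (hc : c ≠ 0) {w : L}
    (hw : T w = c • w) : w ∈ E c⁻¹ := by
  rw [hE, hw, inv_smul_smul₀ hc]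

theorem pos_of_mem (hE : ∀ Γ w, w ∈ E Γ ↔ w = Γ • T w) (hpos : ∀ x, 0 ≤ ⟪T x, x⟫_ℝ) {Γ : ℝ}
    {w : L} (hw : w ∈ E Γ) (h0 : w ≠ 0) : 0 < Γ := by
  have h1 : ‖w‖ ^ 2 = Γ * ⟪T w, w⟫_ℝ := by
    rw [← real_inner_smul_left, ← (hE Γ w).1 hw, real_inner_self_eq_norm_sq]
  have h2 : 0 < ‖w‖ ^ 2 := by positivity
  by_contra! h
  have := mul_nonpos_of_nonpos_of_nonneg h (hpos w)
  linarith

theorem one_le_mul_norm_of_mem (hE : ∀ Γ w, w ∈ E Γ ↔ w = Γ • T w)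
    (hpos : ∀ x, 0 ≤ ⟪T x, x⟫_ℝ) {Γ : ℝ} {w : L} (hw : w ∈ E Γ) (h0 : w ≠ 0) :
    1 ≤ Γ * ‖T‖ := by
  have hΓ := pos_of_mem hE hpos hw h0
  have h1 : ‖w‖ ≤ Γ * (‖T‖ * ‖w‖) := by
    conv_lhs => rw [(hE Γ w).1 hw, norm_smul, Real.norm_of_nonneg hΓ.le]
    gcongr
    exact T.le_opNorm w
  refine le_of_mul_le_mul_right ?_ (norm_pos_iff.2 h0)
  linarith

theorem lowSpan_eq_bot (hE : ∀ Γ w, w ∈ E Γ ↔ w = Γ • T w) (hpos : ∀ x, 0 ≤ ⟪T x, x⟫_ℝ)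
    {μ : ℝ} (hμ : μ * ‖T‖ < 1) : lowSpan E μ = ⊥ := by
  rw [eq_bot_iff, lowSpan_le_iff]
  intro ν hν w hw
  by_contra h0
  have h1 := one_le_mul_norm_of_mem hE hpos hw h0
  have h2 := mul_le_mul_of_nonneg_right hν (norm_nonneg T)
  linarith

/-- An eigenvector forces `1 ≤ Γ ‖T‖`, so nothing is counted below this level. It makes the infimum
in `countingValue` bounded below, and later positive; the `+ 1` covers `T = 0`. -/
theorem inv_le_of_le_rank (hE : ∀ Γ w, w ∈ E Γ ↔ w = Γ • T w) (hpos : ∀ x, 0 ≤ ⟪T x, x⟫_ℝ)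
    {k : ℕ} (hk : 1 ≤ k) {μ : ℝ} (hμ : (k : Cardinal) ≤ Module.rank ℝ (lowSpan E μ)) :
    (‖T‖ + 1)⁻¹ ≤ μ := by
  by_contra! h
  have hT := norm_nonneg T
  have h1 : μ * ‖T‖ < 1 := by
    have h2 : (‖T‖ + 1)⁻¹ * ‖T‖ < 1 := by
      rw [inv_mul_lt_iff₀ (by positivity)]
      linarith
    have := mul_le_mul_of_nonneg_right h.le hT
    linarith
  rw [lowSpan_eq_bot hE hpos h1, rank_bot] at hμ
  have : k ≤ 0 := by exact_mod_cast hμ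
  omega

theorem bddBelow_counting (hE : ∀ Γ w, w ∈ E Γ ↔ w = Γ • T w) (hpos : ∀ x, 0 ≤ ⟪T x, x⟫_ℝ)
    {k : ℕ} (hk : 1 ≤ k) : BddBelow {μ : ℝ | (k : Cardinal) ≤ Module.rank ℝ (lowSpan E μ)} :=
  ⟨(‖T‖ + 1)⁻¹, fun _ hμ => inv_le_of_le_rank hE hpos hk hμ⟩

theorem inner_eq_zero_of_mem (hE : ∀ Γ w, w ∈ E Γ ↔ w = Γ • T w)
    (hsymm : (T : L →ₗ[ℝ] L).IsSymmetric) {Γ Γ' : ℝ} (hne : Γ ≠ Γ') {x y : L} (hx : x ∈ E Γ)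
    (hy : y ∈ E Γ') : ⟪x, y⟫_ℝ = 0 := by
  have h1 : ⟪x, y⟫_ℝ = Γ * ⟪T x, y⟫_ℝ := by
    conv_lhs => rw [(hE Γ x).1 hx, real_inner_smul_left]
  have h2 : ⟪x, y⟫_ℝ = Γ' * ⟪T x, y⟫_ℝ := by
    conv_lhs => rw [(hE Γ' y).1 hy, real_inner_smul_right]
    rw [show ⟪T x, y⟫_ℝ = ⟪x, T y⟫_ℝ from hsymm x y]
  have h3 : (Γ - Γ') * ⟪T x, y⟫_ℝ = 0 := by linarith
  rcases mul_eq_zero.1 h3 with h | h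
  · exact absurd (sub_eq_zero.1 h) hne
  · rw [h1, h, mul_zero]

theorem apply_mem_lowSpan (hE : ∀ Γ w, w ∈ E Γ ↔ w = Γ • T w) (μ : ℝ) :
    ∀ x ∈ lowSpan E μ, T x ∈ lowSpan E μ := by
  change lowSpan E μ ≤ (lowSpan E μ).comap (T : L →ₗ[ℝ] L)
  refine lowSpan_le_iff.2 fun ν hν x hx => le_lowSpan E hν ?_
  rw [hE, ← map_smul, ContinuousLinearMap.coe_coe, ← (hE ν x).1 hx]

theorem lowSpan_le_range (hE : ∀ Γ w, w ∈ E Γ ↔ w = Γ • T w) (μ : ℝ) :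
    lowSpan E μ ≤ LinearMap.range (T : L →ₗ[ℝ] L) := by
  refine lowSpan_le_iff.2 fun ν _ x hx => ⟨ν • x, ?_⟩
  rw [ContinuousLinearMap.coe_coe, map_smul, ← (hE ν x).1 hx]

theorem range_le_ker_orthogonal (hsymm : (T : L →ₗ[ℝ] L).IsSymmetric) :
    LinearMap.range (T : L →ₗ[ℝ] L) ≤ (LinearMap.ker (T : L →ₗ[ℝ] L))ᗮ := by
  rintro _ ⟨x, rfl⟩
  rw [Submodule.mem_orthogonal]
  intro y hy
  rw [← hsymm y x, LinearMap.mem_ker.1 hy, inner_zero_left]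

variable [CompleteSpace L]

/-- If the dimensions stayed below `k`, some `lowSpan E μ₀` of maximal dimension would contain every
`E ν`. By the spectral theorem nothing is orthogonal to both it and `ker T`, so it would contain the
range of `T`, which is infinite-dimensional. -/
theorem exists_le_rank (hE : ∀ Γ w, w ∈ E Γ ↔ w = Γ • T w)
    (hsymm : (T : L →ₗ[ℝ] L).IsSymmetric) (hcomp : IsCompactOperator T)
    (hinf : ¬ FiniteDimensional ℝ (LinearMap.range (T : L →ₗ[ℝ] L))) (k : ℕ) :
    ∃ μ, (k : Cardinal) ≤ Module.rank ℝ (lowSpan E μ) := by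
  by_contra! hk
  have hfd : ∀ μ, FiniteDimensional ℝ (lowSpan E μ) := fun μ =>
    Module.rank_lt_aleph0_iff.1 ((hk μ).trans Cardinal.natCast_lt_aleph0)
  have hlt : ∀ μ, Module.finrank ℝ (lowSpan E μ) < k := by
    intro μ
    have := hk μ
    rw [← Module.finrank_eq_rank] at this
    exact_mod_cast this
  obtain ⟨μ₀, hμ₀⟩ : ∃ μ₀, ∀ μ, Module.finrank ℝ (lowSpan E μ) ≤
      Module.finrank ℝ (lowSpan E μ₀) := by
    have hfin : (Set.range fun μ => Module.finrank ℝ (lowSpan E μ)).Finite :=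
      (Set.finite_lt_nat k).subset (by rintro _ ⟨μ, rfl⟩; exact hlt μ)
    obtain ⟨_, ⟨μ₀, rfl⟩, h⟩ := hfin.exists_maximal (Set.range_nonempty _)
    exact ⟨μ₀, fun μ => le_of_not_gt fun hgt => hgt.not_ge (h ⟨μ, rfl⟩ hgt.le)⟩
  set V := lowSpan E μ₀ with hV
  have hall : ∀ ν, E ν ≤ V := by
    intro ν
    have h1 : V = lowSpan E (max ν μ₀) := by
      have := hfd (max ν μ₀)
      exact Submodule.eq_of_le_of_finrank_le (lowSpan_mono E (le_max_right _ _)) (hμ₀ _)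
    rw [h1]
    exact le_lowSpan E (le_max_left _ _)
  have hsup : (⨆ c, Module.End.eigenspace (T : Module.End ℝ L) c) ≤
      V ⊔ LinearMap.ker (T : L →ₗ[ℝ] L) := by
    refine iSup_le fun c x hx => ?_
    rw [Module.End.mem_eigenspace_iff] at hx
    rcases eq_or_ne c 0 with rfl | hc
    · exact Submodule.mem_sup_right (by rw [LinearMap.mem_ker, hx, zero_smul])
    · exact Submodule.mem_sup_left (hall _ (mem_of_apply_eq hE hc hx))
  have hbot : Vᗮ ⊓ (LinearMap.ker (T : L →ₗ[ℝ] L))ᗮ = ⊥ := by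
    rw [Submodule.inf_orthogonal, eq_bot_iff,
      ← ContinuousLinearMap.orthogonalComplement_iSup_eigenspaces_eq_bot hcomp hsymm]
    exact Submodule.orthogonal_le hsup
  have hrange : LinearMap.range (T : L →ₗ[ℝ] L) ≤ V := by
    intro y hy
    have hVr : V ≤ LinearMap.range (T : L →ₗ[ℝ] L) := lowSpan_le_range hE μ₀
    have hfdV : FiniteDimensional ℝ V := hfd μ₀
    have h1 : y - V.starProjection y ∈ Vᗮ ⊓ (LinearMap.ker (T : L →ₗ[ℝ] L))ᗮ := by
      refine ⟨V.sub_starProjection_mem_orthogonal y, ?_⟩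
      exact range_le_ker_orthogonal hsymm (sub_mem hy (hVr (V.starProjection_apply_mem y)))
    rw [hbot, Submodule.mem_bot, sub_eq_zero] at h1
    rw [h1]
    exact V.starProjection_apply_mem y
  have := hfd μ₀
  exact hinf (Submodule.finiteDimensional_of_le hrange)

/-- If every `E Γ` with `Γ ≤ μ` lies in the invariant space `V`, then `⟪T x, x⟫ ≤ μ⁻¹ ‖x‖²` on
the orthogonal complement of `V`. -/
theorem mul_inner_le_of_mem_orthogonal (hE : ∀ Γ w, w ∈ E Γ ↔ w = Γ • T w)
    (hsymm : (T : L →ₗ[ℝ] L).IsSymmetric) (hcomp : IsCompactOperator T)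
    (hpos : ∀ x, 0 ≤ ⟪T x, x⟫_ℝ) {μ : ℝ} (hμ : 0 < μ) {V : Submodule ℝ L}
    (hVT : ∀ x ∈ V, T x ∈ V) (hV : ∀ Γ ≤ μ, E Γ ≤ V) {x : L} (hx : x ∈ Vᗮ) :
    μ * ⟪T x, x⟫_ℝ ≤ ‖x‖ ^ 2 := by
  have hinv : ∀ y ∈ Vᗮ, T y ∈ Vᗮ := by
    intro y hy
    rw [Submodule.mem_orthogonal]
    intro z hz
    rw [← show ⟪T z, y⟫_ℝ = ⟪z, T y⟫_ℝ from hsymm z y]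
    exact (Submodule.mem_orthogonal _ _).1 hy _ (hVT z hz)
  let R : Vᗮ →L[ℝ] Vᗮ := T.restrict hinv
  have hRc : IsCompactOperator R := hcomp.restrict' hinv
  have hRs : R.IsSymmetric := hsymm.restrict_invariant hinv
  -- The norm of a self-adjoint operator is its spectral radius, and a nonzero spectral value `c` of
  -- a compact one is an eigenvalue. If `|c| > μ⁻¹`, then `c⁻¹ < μ` puts the eigenvector in `V` as
  -- well as in `Vᗮ`.
  have hnorm : ‖R‖ ≤ μ⁻¹ := by
    by_contra! h
    have h1 : ENNReal.ofReal μ⁻¹ < spectralRadius ℝ R := by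
      rw [R.spectralRadius_eq_nnnorm hRs.isSelfAdjoint, ← enorm_eq_nnnorm, ← ofReal_norm]
      exact (ENNReal.ofReal_lt_ofReal_iff ((inv_pos.2 hμ).trans h)).2 h
    obtain ⟨c, hc⟩ := lt_iSup_iff.1 h1
    obtain ⟨hcs, hc⟩ := lt_iSup_iff.1 hc
    rw [← enorm_eq_nnnorm, ← ofReal_norm] at hc
    have hc' : μ⁻¹ < |c| := (ENNReal.ofReal_lt_ofReal_iff_of_nonneg (inv_pos.2 hμ).le).1 hc
    have hc0 : c ≠ 0 := abs_pos.1 ((inv_pos.2 hμ).trans hc')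
    obtain ⟨y, hy, hy0⟩ := ((hRc.hasEigenvalue_iff_mem_spectrum hc0).2 hcs).exists_hasEigenvector
    rw [Module.End.mem_eigenspace_iff] at hy
    have hTy : T (y : L) = c • (y : L) := congrArg Subtype.val hy
    have hmem := mem_of_apply_eq hE hc0 hTy
    have hy0' : (y : L) ≠ 0 := fun h => hy0 (Subtype.ext h)
    have hcpos : 0 < c := inv_pos.1 (pos_of_mem hE hpos hmem hy0')
    rw [abs_of_pos hcpos] at hc'
    have hyV : (y : L) ∈ V := hV _ ((inv_lt_comm₀ hμ hcpos).1 hc').le hmem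
    refine hy0' ?_
    have := (Submodule.mem_orthogonal _ _).1 y.2 _ hyV
    exact inner_self_eq_zero.1 this
  have h2 : ⟪T x, x⟫_ℝ ≤ μ⁻¹ * ‖x‖ ^ 2 := by
    calc ⟪T x, x⟫_ℝ ≤ ‖T x‖ * ‖x‖ := real_inner_le_norm _ _
      _ = ‖R ⟨x, hx⟩‖ * ‖x‖ := rfl
      _ ≤ (‖R‖ * ‖x‖) * ‖x‖ := by
          gcongr
          exact R.le_opNorm ⟨x, hx⟩
      _ ≤ (μ⁻¹ * ‖x‖) * ‖x‖ := by gcongr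
      _ = μ⁻¹ * ‖x‖ ^ 2 := by ring
  calc μ * ⟪T x, x⟫_ℝ ≤ μ * (μ⁻¹ * ‖x‖ ^ 2) := by gcongr
    _ = ‖x‖ ^ 2 := mul_inv_cancel_left₀ hμ.ne' _

theorem countingValue_pos (hE : ∀ Γ w, w ∈ E Γ ↔ w = Γ • T w)
    (hsymm : (T : L →ₗ[ℝ] L).IsSymmetric) (hcomp : IsCompactOperator T)
    (hpos : ∀ x, 0 ≤ ⟪T x, x⟫_ℝ)
    (hinf : ¬ FiniteDimensional ℝ (LinearMap.range (T : L →ₗ[ℝ] L))) {k : ℕ} (hk : 1 ≤ k) :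
    0 < countingValue E k :=
  (inv_pos.2 (by positivity : 0 < ‖T‖ + 1)).trans_le
    (le_csInf (exists_le_rank hE hsymm hcomp hinf k) fun _ hμ =>
      inv_le_of_le_rank hE hpos hk hμ)

theorem countingValue_le (hE : ∀ Γ w, w ∈ E Γ ↔ w = Γ • T w)
    (hsymm : (T : L →ₗ[ℝ] L).IsSymmetric) (hcomp : IsCompactOperator T)
    (hpos : ∀ x, 0 ≤ ⟪T x, x⟫_ℝ)
    (hinf : ¬ FiniteDimensional ℝ (LinearMap.range (T : L →ₗ[ℝ] L))) {k l : ℕ} (hk : 1 ≤ k)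
    (hkl : k ≤ l) : countingValue E k ≤ countingValue E l :=
  csInf_le_csInf (bddBelow_counting hE hpos hk) (exists_le_rank hE hsymm hcomp hinf l)
    fun _ hμ => le_trans (Nat.cast_le.2 hkl) (Set.mem_ofPred_eq ▸ hμ)

omit [CompleteSpace L] in
/-- An orthonormal basis of `lowSpan E μ` consisting of eigenvectors of `T`, ordered by the
parameter. -/
theorem exists_orthonormal_lowSpan (hE : ∀ Γ w, w ∈ E Γ ↔ w = Γ • T w)
    (hsymm : (T : L →ₗ[ℝ] L).IsSymmetric) (hpos : ∀ x, 0 ≤ ⟪T x, x⟫_ℝ) {μ : ℝ} {m : ℕ}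
    [FiniteDimensional ℝ (lowSpan E μ)] (hm : Module.finrank ℝ (lowSpan E μ) = m) :
    ∃ (b : OrthonormalBasis (Fin m) ℝ (lowSpan E μ)) (Γ : Fin m → ℝ), Monotone Γ ∧
      ∀ i, (b i : L) ∈ E (Γ i) := by
  have hinv := apply_mem_lowSpan (T := T) hE μ
  have hs := hsymm.restrict_invariant hinv
  have happ : ∀ i, T (hs.eigenvectorBasis hm i : L) =
      hs.eigenvalues hm i • (hs.eigenvectorBasis hm i : L) := fun i =>
    congrArg Subtype.val (hs.apply_eigenvectorBasis hm i)
  have hne : ∀ i, (hs.eigenvectorBasis hm i : L) ≠ 0 := fun i h =>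
    (hs.eigenvectorBasis hm).toBasis.ne_zero i (by simpa using Subtype.ext h)
  -- A kernel vector in `lowSpan E μ` lies in the range of `T`, which is orthogonal to the kernel,
  -- so it is zero.
  have hne0 : ∀ i, hs.eigenvalues hm i ≠ 0 := by
    intro i h0
    have h1 := happ i
    rw [h0, zero_smul] at h1
    have h2 := range_le_ker_orthogonal hsymm
      (lowSpan_le_range hE μ (hs.eigenvectorBasis hm i).2)
    exact hne i (inner_self_eq_zero.1
      ((Submodule.mem_orthogonal _ _).1 h2 _ (LinearMap.mem_ker.2 h1)))
  have hmem : ∀ i, (hs.eigenvectorBasis hm i : L) ∈ E (hs.eigenvalues hm i)⁻¹ := fun i =>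
    mem_of_apply_eq hE (hne0 i) (happ i)
  have hp : ∀ i, 0 < hs.eigenvalues hm i := fun i =>
    inv_pos.1 (pos_of_mem hE hpos (hmem i) (hne i))
  exact ⟨hs.eigenvectorBasis hm, fun i => (hs.eigenvalues hm i)⁻¹, fun i j hij =>
    inv_anti₀ (hp j) (hs.eigenvalues_antitone hm hij), hmem⟩

omit [CompleteSpace L] in
-- Indices of `b` start at 0. At level `Γ i` the vectors `b 0, …, b i` are all counted. Below that
-- level every eigenvector is orthogonal to each `b j` with `i ≤ j`, so at most `i` dimensions are
-- available.
theorem countingValue_eq_of_basis (hE : ∀ Γ w, w ∈ E Γ ↔ w = Γ • T w)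
    (hsymm : (T : L →ₗ[ℝ] L).IsSymmetric) (hpos : ∀ x, 0 ≤ ⟪T x, x⟫_ℝ) {μ : ℝ} {m : ℕ}
    (b : OrthonormalBasis (Fin m) ℝ (lowSpan E μ)) {Γ : Fin m → ℝ} (hΓ : Monotone Γ)
    (hb : ∀ i, (b i : L) ∈ E (Γ i)) (i : Fin m) : countingValue E (i + 1) = Γ i := by
  have horth : Orthonormal ℝ fun j => (b j : L) :=
    b.orthonormal.comp_linearIsometry (lowSpan E μ).subtypeₗᵢ
  -- Otherwise `b i` would be orthogonal to all of `lowSpan E μ`, hence to itself.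
  have hle : Γ i ≤ μ := by
    by_contra! h
    have h1 : lowSpan E μ ≤ (Submodule.span ℝ {(b i : L)})ᗮ := by
      refine lowSpan_le_iff.2 fun ν hν x hx => ?_
      rw [Submodule.mem_orthogonal_singleton_iff_inner_right]
      exact inner_eq_zero_of_mem hE hsymm (hν.trans_lt h).ne' (hb i) hx
    have h2 := Submodule.mem_orthogonal_singleton_iff_inner_right.1 (h1 (b i).2)
    have h3 : ‖(b i : L)‖ = 1 := horth.1 i
    rw [inner_self_eq_zero.1 h2, norm_zero] at h3
    exact zero_ne_one h3
  have hmem : ((i + 1 : ℕ) : Cardinal) ≤ Module.rank ℝ (lowSpan E (Γ i)) := by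
    have hbi : ∀ j : Fin (i + 1), (b (Fin.castLE i.2 j) : L) ∈ lowSpan E (Γ i) := fun j =>
      le_lowSpan E (hΓ (Fin.le_def.2 (Nat.lt_succ_iff.1 j.2))) (hb _)
    have hli : LinearIndependent ℝ fun j : Fin (i + 1) =>
        (⟨b (Fin.castLE i.2 j), hbi j⟩ : lowSpan E (Γ i)) := by
      refine LinearIndependent.of_comp (lowSpan E (Γ i)).subtype ?_
      exact horth.linearIndependent.comp _ (Fin.castLE_injective i.2)
    simpa using hli.cardinal_lift_le_rank
  have hlow : ∀ ν, ((i + 1 : ℕ) : Cardinal) ≤ Module.rank ℝ (lowSpan E ν) → Γ i ≤ ν := by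
    intro ν hν
    by_contra! hlt
    have hspan : lowSpan E ν ≤ Submodule.span ℝ (Set.range fun j : Fin i =>
        (b (Fin.castLE i.2.le j) : L)) := by
      refine lowSpan_le_iff.2 fun ν' hν' x hx => ?_
      have hxμ : x ∈ lowSpan E μ := le_lowSpan E ((hν'.trans hlt.le).trans hle) hx
      have hsum := congrArg Subtype.val (b.sum_repr' ⟨x, hxμ⟩)
      rw [Submodule.coe_sum] at hsum
      change _ = x at hsum
      rw [← hsum]
      refine Submodule.sum_mem _ fun j _ => ?_
      rcases lt_or_ge j i with hji | hji
      · exact Submodule.smul_mem _ _ (Submodule.subset_span ⟨⟨j, hji⟩, rfl⟩)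
      · have h0 : ⟪b j, (⟨x, hxμ⟩ : lowSpan E μ)⟫_ℝ = 0 :=
          inner_eq_zero_of_mem hE hsymm ((hν'.trans_lt hlt).trans_le (hΓ hji)).ne' (hb j) hx
        rw [h0, zero_smul]
        exact Submodule.zero_mem _
    have h1 := hν.trans (Submodule.rank_mono hspan)
    have := FiniteDimensional.span_of_finite ℝ (Set.finite_range fun j : Fin i =>
      (b (Fin.castLE i.2.le j) : L))
    rw [← Module.finrank_eq_rank, Nat.cast_le] at h1
    have h2 := h1.trans (finrank_range_le_card _)
    rw [Fintype.card_fin] at h2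
    omega
  exact le_antisymm (csInf_le (bddBelow_counting hE hpos (Nat.le_add_left 1 i)) hmem)
    (le_csInf ⟨Γ i, hmem⟩ hlow)

/-- Either the `m`-th and the `(m+1)`-st values agree, or there are orthonormal eigenvectors for
the first `m` values and the `(m+1)`-st value bounds `T` on their orthogonal complement. -/
theorem countingValue_dichotomy (hE : ∀ Γ w, w ∈ E Γ ↔ w = Γ • T w)
    (hsymm : (T : L →ₗ[ℝ] L).IsSymmetric) (hcomp : IsCompactOperator T)
    (hpos : ∀ x, 0 ≤ ⟪T x, x⟫_ℝ)
    (hinf : ¬ FiniteDimensional ℝ (LinearMap.range (T : L →ₗ[ℝ] L))) {m : ℕ} (hm : 1 ≤ m) :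
    countingValue E m = countingValue E (m + 1) ∨
      countingValue E m < countingValue E (m + 1) ∧
      ∃ w : Fin m → L, Orthonormal ℝ w ∧ (∀ i : Fin m, w i ∈ E (countingValue E (i + 1))) ∧
        ∀ x, (∀ i, ⟪w i, x⟫_ℝ = 0) → countingValue E (m + 1) * ⟪T x, x⟫_ℝ ≤ ‖x‖ ^ 2 := by
  refine (countingValue_le hE hsymm hcomp hpos hinf hm m.le_succ).eq_or_lt.imp_right
    fun hlt => ⟨hlt, ?_⟩
  -- A level `μ` strictly below the `(m+1)`-st value that already counts `m` has `lowSpan E μ` of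
  -- dimension exactly `m`.
  obtain ⟨μ, hμ, hμlt⟩ := exists_lt_of_csInf_lt (exists_le_rank hE hsymm hcomp hinf m) hlt
  have hrank : ∀ ν < countingValue E (m + 1), Module.rank ℝ (lowSpan E ν) ≤ m := by
    intro ν hν
    have h : Module.rank ℝ (lowSpan E ν) < (m + 1 : ℕ) := by
      have h' := notMem_of_lt_csInf hν (bddBelow_counting hE hpos (Nat.le_add_left 1 m))
      exact lt_of_not_ge h'
    obtain ⟨k, hk⟩ := Cardinal.lt_aleph0.1 (h.trans Cardinal.natCast_lt_aleph0)
    rw [hk, Nat.cast_lt] at h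
    rw [hk, Nat.cast_le]
    omega
  have hfd : ∀ ν < countingValue E (m + 1), FiniteDimensional ℝ (lowSpan E ν) := fun ν hν =>
    Module.rank_lt_aleph0_iff.1 ((hrank ν hν).trans_lt Cardinal.natCast_lt_aleph0)
  have := hfd μ hμlt
  have hfin : Module.finrank ℝ (lowSpan E μ) = m :=
    Module.finrank_eq_of_rank_eq (le_antisymm (hrank μ hμlt) hμ)
  obtain ⟨b, Γ, hΓ, hb⟩ := exists_orthonormal_lowSpan hE hsymm hpos hfin
  refine ⟨fun i => b i, b.orthonormal.comp_linearIsometry (lowSpan E μ).subtypeₗᵢ, fun i => ?_,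
    fun x hx => ?_⟩
  · rw [countingValue_eq_of_basis hE hsymm hpos b hΓ hb]
    exact hb i
  have hxV : x ∈ (lowSpan E μ)ᗮ := by
    rw [Submodule.mem_orthogonal]
    intro v hv
    have hsum := congrArg Subtype.val (b.sum_repr' ⟨v, hv⟩)
    rw [Submodule.coe_sum] at hsum
    change _ = v at hsum
    rw [← hsum, sum_inner]
    refine Finset.sum_eq_zero fun i _ => ?_
    rw [Submodule.coe_smul, real_inner_smul_left, hx i, mul_zero]
  -- Between `μ` and the `(m+1)`-st value the span cannot grow, so the spectral bound holds at every
  -- lower level `ν`; the limit below reaches the value itself.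
  have key : ∀ ν < countingValue E (m + 1), ν * ⟪T x, x⟫_ℝ ≤ ‖x‖ ^ 2 := by
    intro ν hν
    rcases le_or_gt ν 0 with h0 | h0
    · exact (mul_nonpos_of_nonpos_of_nonneg h0 (hpos x)).trans (sq_nonneg _)
    refine mul_inner_le_of_mem_orthogonal hE hsymm hcomp hpos h0 (V := lowSpan E μ)
      (apply_mem_lowSpan hE μ) (fun Γ' hΓ' => ?_) hxV
    have hmax := max_lt hν hμlt
    have := hfd _ hmax
    have heq : lowSpan E μ = lowSpan E (max ν μ) := by
      refine Submodule.eq_of_le_of_finrank_le (lowSpan_mono E (le_max_right _ _)) ?_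
      rw [hfin]
      exact Module.finrank_le_of_rank_le (hrank _ hmax)
    rw [heq]
    exact le_lowSpan E (hΓ'.trans (le_max_left _ _))
  exact le_of_tendsto' (b := ‖x‖ ^ 2) (f := fun k : ℕ => (countingValue E (m + 1) -
      1 / ((k : ℝ) + 1)) * ⟪T x, x⟫_ℝ)
    (by simpa using (tendsto_one_div_add_atTop_nhds_zero_nat.const_sub
      (countingValue E (m + 1))).mul_const ⟪T x, x⟫_ℝ)
    fun k => key _ (sub_lt_self _ (by positivity))

end Counting

/-- An operator that is small up to finite rank operators is compact. -/
theorem isCompactOperator_of_finiteRank_estimate {H L : Type*} [NormedAddCommGroup H]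
    [InnerProductSpace ℝ H] [CompleteSpace H] [NormedAddCommGroup L] [NormedSpace ℝ L]
    [CompleteSpace L] (S : H →L[ℝ] L)
    (hS : ∀ ε > 0, ∃ (ι : Type) (_ : Fintype ι) (F : H →L[ℝ] EuclideanSpace ℝ ι),
      ∀ g, ‖S g‖ ^ 2 ≤ ε * ‖g‖ ^ 2 + ‖F g‖ ^ 2) : IsCompactOperator S := by
  refine isClosed_setOfPred_isCompactOperator.closure_subset (Metric.mem_closure_iff.2 ?_)
  intro ε hε
  obtain ⟨ι, _, F, hF⟩ := hS ((ε / 2) ^ 2) (by positivity)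
  -- `Kᗮ` is finite-dimensional because `F` is injective on it. On `K` the estimate reads `‖S g‖ ≤
  -- (ε / 2) ‖g‖`, so `S` is within `ε / 2` of a finite-rank operator.
  set K : Submodule ℝ H := LinearMap.ker (F : H →ₗ[ℝ] EuclideanSpace ℝ ι)
  have hKc : IsClosed (K : Set H) := F.isClosed_ker
  have : CompleteSpace K := hKc.completeSpace_coe
  have hfd : FiniteDimensional ℝ Kᗮ := by
    refine FiniteDimensional.of_injective
      ((F : H →ₗ[ℝ] EuclideanSpace ℝ ι).comp Kᗮ.subtype) ?_
    rw [← LinearMap.ker_eq_bot, LinearMap.ker_eq_bot']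
    intro x hx
    have h1 : (x : H) ∈ K ⊓ Kᗮ := ⟨LinearMap.mem_ker.2 hx, x.2⟩
    rw [Submodule.inf_orthogonal_eq_bot, Submodule.mem_bot] at h1
    exact Subtype.ext h1
  refine ⟨S ∘L Kᗮ.starProjection, ?_, ?_⟩
  · have hid : IsCompactOperator (id : Kᗮ → Kᗮ) :=
      (isCompactOperator_id_iff_finiteDimensional (𝕜 := ℝ)).2 hfd
    exact (hid.comp_clm Kᗮ.orthogonalProjectionOnto).clm_comp (S ∘L Kᗮ.subtypeL)
  · rw [dist_eq_norm]
    refine lt_of_le_of_lt (ContinuousLinearMap.opNorm_le_bound _ (half_pos hε).le fun g => ?_)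
      (half_lt_self hε)
    have h1 : (S - S ∘L Kᗮ.starProjection) g = S (K.starProjection g) := by
      have h2 := K.starProjection_add_starProjection_orthogonal g
      rw [sub_apply, ContinuousLinearMap.comp_apply, ← map_sub]
      congr 1
      exact sub_eq_of_eq_add h2.symm
    have h3 : F (K.starProjection g) = 0 := LinearMap.mem_ker.1 (K.starProjection_apply_mem g)
    have h4 := hF (K.starProjection g)
    rw [h3, norm_zero, zero_pow two_ne_zero, add_zero, ← mul_pow] at h4
    rw [h1]
    refine (le_of_sq_le_sq h4 (by positivity)).trans ?_
    gcongr
    exact K.norm_starProjection_apply_le g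

/-! ### Translation estimate and the cubical grid -/

section Cells

variable {n : ℕ}

/-- The sum of the squares of the partial derivatives. -/
noncomputable def gradSq (f : EuclideanSpace ℝ (Fin n) → ℝ) (x : EuclideanSpace ℝ (Fin n)) : ℝ :=
  ∑ p, pderiv p f x ^ 2

theorem continuous_gradSq {f : EuclideanSpace ℝ (Fin n) → ℝ} (hf : ContDiff ℝ ∞ f) :
    Continuous (gradSq f) :=
  continuous_finsetSum _ fun p _ => (contDiff_pderiv p hf).continuous.pow 2

theorem fderiv_apply_sq_le (f : EuclideanSpace ℝ (Fin n) → ℝ) (x h : EuclideanSpace ℝ (Fin n)) :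
    (fderiv ℝ f x h) ^ 2 ≤ ‖h‖ ^ 2 * gradSq f x := by
  have h1 : fderiv ℝ f x h = ∑ p, h p * pderiv p f x := by
    conv_lhs => rw [← (EuclideanSpace.basisFun (Fin n) ℝ).sum_repr h]
    simp [pderiv]
  rw [h1, EuclideanSpace.norm_sq_eq, gradSq]
  refine (Finset.sum_mul_sq_le_sq_mul_sq _ _ _).trans (le_of_eq ?_)
  simp

theorem sq_integral_le {g : ℝ → ℝ} (hg : Continuous g) :
    (∫ t in (0 : ℝ)..1, g t) ^ 2 ≤ ∫ t in (0 : ℝ)..1, g t ^ 2 := by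
  set c := ∫ t in (0 : ℝ)..1, g t with hc
  have h : 0 ≤ ∫ t in (0 : ℝ)..1, (g t - c) ^ 2 :=
    intervalIntegral.integral_nonneg zero_le_one fun t _ => sq_nonneg _
  have h1 : ∫ t in (0 : ℝ)..1, (g t - c) ^ 2 = (∫ t in (0 : ℝ)..1, g t ^ 2) - c ^ 2 := by
    have : ∀ t, (g t - c) ^ 2 = g t ^ 2 - (2 * c * g t - c ^ 2) := fun t => by ring
    simp only [this]
    rw [intervalIntegral.integral_sub, intervalIntegral.integral_sub,
      intervalIntegral.integral_const_mul, ← hc]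
    · simp
      ring
    all_goals exact Continuous.intervalIntegrable (by fun_prop) _ _
  linarith

theorem sq_sub_le_integral {f : EuclideanSpace ℝ (Fin n) → ℝ} (hf : ContDiff ℝ ∞ f)
    (x h : EuclideanSpace ℝ (Fin n)) :
    (f (x + h) - f x) ^ 2 ≤ ∫ t in (0 : ℝ)..1, ‖h‖ ^ 2 * gradSq f (x + t • h) := by
  have hcont : Continuous fun t : ℝ => fderiv ℝ f (x + t • h) h :=
    ((hf.continuous_fderiv (by simp)).comp (by fun_prop)).clm_apply continuous_const
  have hftc : ∫ t in (0 : ℝ)..1, fderiv ℝ f (x + t • h) h = f (x + h) - f x := by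
    have hd : ∀ t : ℝ, HasDerivAt (fun t : ℝ => f (x + t • h)) (fderiv ℝ f (x + t • h) h) t := by
      intro t
      have h1 : HasDerivAt (fun t : ℝ => x + t • h) h t := by
        simpa using ((hasDerivAt_id t).smul_const h).const_add x
      exact ((hf.differentiable (by simp) (x + t • h)).hasFDerivAt).comp_hasDerivAt t h1
    rw [intervalIntegral.integral_eq_sub_of_hasDerivAt (fun t _ => hd t)
      (hcont.intervalIntegrable _ _)]
    simp
  rw [← hftc]
  refine (sq_integral_le hcont).trans ?_
  refine intervalIntegral.integral_mono_on zero_le_one ((hcont.pow 2).intervalIntegrable _ _) ?_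
    fun t _ => fderiv_apply_sq_le f _ h
  exact (continuous_const.mul ((continuous_gradSq hf).comp (by fun_prop))).intervalIntegrable _ _

theorem gradSq_nonneg (f : EuclideanSpace ℝ (Fin n) → ℝ) (x : EuclideanSpace ℝ (Fin n)) :
    0 ≤ gradSq f x := Finset.sum_nonneg fun _ _ => sq_nonneg _

/-- The translation estimate in `L²`. -/
theorem lintegral_sq_sub_le {f : EuclideanSpace ℝ (Fin n) → ℝ} (hf : ContDiff ℝ ∞ f)
    (h : EuclideanSpace ℝ (Fin n)) :
    ∫⁻ x, ENNReal.ofReal ((f (x + h) - f x) ^ 2) ≤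
      ENNReal.ofReal (‖h‖ ^ 2) * ∫⁻ x, ENNReal.ofReal (gradSq f x) := by
  have hc := continuous_gradSq hf
  calc ∫⁻ x, ENNReal.ofReal ((f (x + h) - f x) ^ 2)
      ≤ ∫⁻ x, ∫⁻ t in Set.Ioc (0 : ℝ) 1, ENNReal.ofReal (‖h‖ ^ 2 * gradSq f (x + t • h)) := by
        refine lintegral_mono fun x => ?_
        rw [← ofReal_integral_eq_lintegral_ofReal, ← intervalIntegral.integral_of_le zero_le_one]
        · exact ENNReal.ofReal_le_ofReal (sq_sub_le_integral hf x h)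
        · exact (Continuous.integrableOn_Icc (by fun_prop)).mono_set Set.Ioc_subset_Icc_self
        · exact Eventually.of_forall fun t => mul_nonneg (sq_nonneg _) (gradSq_nonneg f _)
    _ = ∫⁻ t in Set.Ioc (0 : ℝ) 1, ∫⁻ x, ENNReal.ofReal (‖h‖ ^ 2 * gradSq f (x + t • h)) := by
        refine lintegral_lintegral_swap
          (ENNReal.measurable_ofReal.comp (Continuous.measurable ?_)).aemeasurable
        fun_prop
    _ = ∫⁻ t in Set.Ioc (0 : ℝ) 1, ∫⁻ x, ENNReal.ofReal (‖h‖ ^ 2 * gradSq f x) := by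
        refine lintegral_congr fun t => ?_
        exact lintegral_add_right_eq_self (fun x => ENNReal.ofReal (‖h‖ ^ 2 * gradSq f x)) _
    _ = ENNReal.ofReal (‖h‖ ^ 2) * ∫⁻ x, ENNReal.ofReal (gradSq f x) := by
        simp only [ENNReal.ofReal_mul (sq_nonneg ‖h‖)]
        rw [lintegral_const_mul _ (by fun_prop)]
        simp

/-- The half-open cell of side `s` with index `j`. -/
def cell (s : ℝ) (j : Fin n → ℤ) : Set (EuclideanSpace ℝ (Fin n)) :=
  {x | ∀ p, x p ∈ Set.Ico (s * j p) (s * j p + s)}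

/-- The closed cube of side `2 s` about the origin. -/
def cube (n : ℕ) (s : ℝ) : Set (EuclideanSpace ℝ (Fin n)) :=
  {x | ∀ p, x p ∈ Set.Icc (-s) s}

theorem measurableSet_cell (s : ℝ) (j : Fin n → ℤ) : MeasurableSet (cell s j) := by
  rw [cell, Set.ofPred_forall]
  refine MeasurableSet.iInter fun p => ?_
  exact measurableSet_Ico.preimage (by fun_prop)

theorem measurableSet_cube (s : ℝ) : MeasurableSet (cube n s) := by
  rw [cube, Set.ofPred_forall]
  refine MeasurableSet.iInter fun p => ?_
  exact measurableSet_Icc.preimage (by fun_prop)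

theorem volume_cell (s : ℝ) (j : Fin n → ℤ) : volume (cell s j) = ENNReal.ofReal s ^ n := by
  have h : cell s j = (WithLp.ofLp : EuclideanSpace ℝ (Fin n) → Fin n → ℝ) ⁻¹'
      (Set.univ.pi fun p => Set.Ico (s * j p) (s * j p + s)) := by
    ext x
    simp [cell]
  rw [h, (PiLp.volume_preserving_ofLp (Fin n)).measure_preimage
    (MeasurableSet.univ_pi fun _ => measurableSet_Ico).nullMeasurableSet, Real.volume_pi_Ico]
  simp

theorem volume_cube (s : ℝ) : volume (cube n s) = ENNReal.ofReal (2 * s) ^ n := by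
  have h : cube n s = (WithLp.ofLp : EuclideanSpace ℝ (Fin n) → Fin n → ℝ) ⁻¹'
      (Set.univ.pi fun p => Set.Icc (-s) s) := by
    ext x
    simp only [cube, Set.mem_preimage, Set.mem_univ_pi]
    rfl
  rw [h, (PiLp.volume_preserving_ofLp (Fin n)).measure_preimage
    (MeasurableSet.univ_pi fun _ => measurableSet_Icc).nullMeasurableSet, volume_pi_pi]
  simp [two_mul]

theorem norm_sq_le_of_mem_cube {s : ℝ} {h : EuclideanSpace ℝ (Fin n)} (hh : h ∈ cube n s) :
    ‖h‖ ^ 2 ≤ n * s ^ 2 := by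
  rw [EuclideanSpace.norm_sq_eq]
  refine (Finset.sum_le_card_nsmul _ _ (s ^ 2) fun p _ => ?_).trans (le_of_eq (by simp))
  rw [Real.norm_eq_abs, sq_abs]
  exact sq_le_sq' (hh p).1 (hh p).2

theorem mem_cell_floor {s : ℝ} (hs : 0 < s) (x : EuclideanSpace ℝ (Fin n)) :
    x ∈ cell s fun p => ⌊x p / s⌋ := by
  intro p
  have h1 := Int.floor_le (x p / s)
  have h2 := Int.lt_floor_add_one (x p / s)
  rw [le_div_iff₀ hs] at h1
  rw [div_lt_iff₀ hs] at h2
  constructor <;> linarith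

theorem disjoint_cell {s : ℝ} (hs : 0 < s) {i j : Fin n → ℤ} (hij : i ≠ j) :
    Disjoint (cell s i) (cell s j) := by
  have key : ∀ (k : Fin n → ℤ) (x : EuclideanSpace ℝ (Fin n)), x ∈ cell s k →
      (fun p => ⌊x p / s⌋) = k := by
    intro k x hx
    funext p
    rw [Int.floor_eq_iff, le_div_iff₀ hs, div_lt_iff₀ hs]
    have := hx p
    constructor <;> linarith [this.1, this.2]
  rw [Set.disjoint_left]
  intro x hi hj
  exact hij ((key i x hi).symm.trans (key j x hj))

theorem sub_mem_cube {s : ℝ} {j : Fin n → ℤ} {x y : EuclideanSpace ℝ (Fin n)} (hx : x ∈ cell s j)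
    (hy : y ∈ cell s j) : y - x ∈ cube n s := by
  intro p
  have h1 := hx p
  have h2 := hy p
  rw [PiLp.sub_apply]
  constructor <;> linarith [h1.1, h1.2, h2.1, h2.2]

end Cells

/-! ### Poincaré inequality on cells -/

section CellEstimate

variable {n : ℕ}

/-- Put `y = x + h`: two points of one cell differ by an element of the cube. The cells being
disjoint, the sum is at most the integral over all `x`, and the translation estimate applies for
each `h`. -/
theorem sum_lintegral_cell_le {f : EuclideanSpace ℝ (Fin n) → ℝ} (hf : ContDiff ℝ ∞ f) {s : ℝ}
    (hs : 0 < s) (J : Finset (Fin n → ℤ)) :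
    ∑ j ∈ J, ∫⁻ x in cell s j, ∫⁻ y in cell s j, ENNReal.ofReal ((f y - f x) ^ 2) ≤
      ENNReal.ofReal ((2 * s) ^ n * (n * s ^ 2)) * ∫⁻ x, ENNReal.ofReal (gradSq f x) := by
  have hfc := hf.continuous
  have hcell : ∀ j, ∀ x ∈ cell s j, ∫⁻ y in cell s j, ENNReal.ofReal ((f y - f x) ^ 2) ≤
      ∫⁻ h in cube n s, ENNReal.ofReal ((f (x + h) - f x) ^ 2) := by
    intro j x hx
    rw [← lintegral_indicator (measurableSet_cell s j),
      ← lintegral_indicator (measurableSet_cube s), ← lintegral_add_left_eq_self _ x]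
    refine lintegral_mono fun h => ?_
    by_cases hh : x + h ∈ cell s j
    · have : h ∈ cube n s := by simpa using sub_mem_cube hx hh
      rw [Set.indicator_of_mem hh, Set.indicator_of_mem this]
    · rw [Set.indicator_of_notMem hh]
      exact zero_le
  calc ∑ j ∈ J, ∫⁻ x in cell s j, ∫⁻ y in cell s j, ENNReal.ofReal ((f y - f x) ^ 2)
      ≤ ∑ j ∈ J, ∫⁻ x in cell s j, ∫⁻ h in cube n s, ENNReal.ofReal ((f (x + h) - f x) ^ 2) :=
        Finset.sum_le_sum fun j _ => setLIntegral_mono' (measurableSet_cell s j) (hcell j)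
    _ = ∫⁻ x in ⋃ j ∈ J, cell s j, ∫⁻ h in cube n s, ENNReal.ofReal ((f (x + h) - f x) ^ 2) := by
        rw [lintegral_biUnion_finset (fun i _ j _ hij => disjoint_cell hs hij)
          fun j _ => measurableSet_cell s j]
    _ ≤ ∫⁻ x, ∫⁻ h in cube n s, ENNReal.ofReal ((f (x + h) - f x) ^ 2) :=
        setLIntegral_le_lintegral _ _
    _ = ∫⁻ h in cube n s, ∫⁻ x, ENNReal.ofReal ((f (x + h) - f x) ^ 2) := by
        refine lintegral_lintegral_swap
          (ENNReal.measurable_ofReal.comp (Continuous.measurable ?_)).aemeasurable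
        fun_prop
    _ ≤ ∫⁻ _ in cube n s, ENNReal.ofReal (n * s ^ 2) * ∫⁻ x, ENNReal.ofReal (gradSq f x) := by
        refine setLIntegral_mono' (measurableSet_cube s) fun h hh => ?_
        refine (lintegral_sq_sub_le hf h).trans ?_
        gcongr
        exact norm_sq_le_of_mem_cube hh
    _ = ENNReal.ofReal ((2 * s) ^ n * (n * s ^ 2)) * ∫⁻ x, ENNReal.ofReal (gradSq f x) := by
        rw [setLIntegral_const, volume_cube,
          ENNReal.ofReal_mul (p := (2 * s) ^ n) (by positivity),
          ENNReal.ofReal_pow (by positivity)]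
        ring

/-- With `M` the mean of `f` over the cell, `a² ≤ 2 (a - M)² + 2 M²`, and by Jensen `(a - M)²` is at
most the mean of `(f - a)²`. -/
theorem sq_le_cell {f : EuclideanSpace ℝ (Fin n) → ℝ} (hf : ContDiff ℝ ∞ f)
    (hc : HasCompactSupport f) {s : ℝ} (hs : 0 < s) (j : Fin n → ℤ) (a : ℝ) :
    a ^ 2 ≤ 2 / s ^ n * (∫ y in cell s j, (f y - a) ^ 2) +
      2 / (s ^ n) ^ 2 * (∫ y in cell s j, f y) ^ 2 := by
  have hV : volume.real (cell s j) = s ^ n := by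
    rw [measureReal_def, volume_cell, ENNReal.toReal_pow, ENNReal.toReal_ofReal hs.le]
  have hVpos : 0 < s ^ n := by positivity
  have : IsFiniteMeasure (volume.restrict (cell s j)) := by
    refine isFiniteMeasure_restrict.2 ?_
    rw [volume_cell]
    exact ENNReal.pow_ne_top ENNReal.ofReal_ne_top
  have h1 : Integrable f (volume.restrict (cell s j)) :=
    hf.continuous.integrable_of_hasCompactSupport hc
  have h2 : Integrable (fun y => f y ^ 2) (volume.restrict (cell s j)) :=
    (hf.continuous.pow 2).integrable_of_hasCompactSupport (by
      simpa only [sq] using hc.mul_right)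
  set V := s ^ n
  set A := ∫ y in cell s j, f y
  set F := ∫ y in cell s j, f y ^ 2
  have hI : ∀ b : ℝ, ∫ y in cell s j, (f y - b) ^ 2 = F - 2 * b * A + b ^ 2 * V := by
    intro b
    have : ∀ y, (f y - b) ^ 2 = f y ^ 2 - 2 * b * f y + b ^ 2 := fun y => by ring
    simp only [this]
    have h12 : Integrable (fun y => f y ^ 2 - 2 * b * f y) (volume.restrict (cell s j)) :=
      h2.sub (h1.const_mul (2 * b))
    rw [integral_add h12 (integrable_const _), integral_sub h2 (h1.const_mul _),
      integral_const_mul, integral_const]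
    simp only [measureReal_restrict_apply_univ, hV, smul_eq_mul]
    ring
  have hF : A ^ 2 / V ≤ F := by
    have h0 : 0 ≤ ∫ y in cell s j, (f y - A / V) ^ 2 := integral_nonneg fun y => sq_nonneg _
    rw [hI] at h0
    have : F - 2 * (A / V) * A + (A / V) ^ 2 * V = F - A ^ 2 / V := by
      field_simp
      ring
    linarith
  rw [hI]
  have h3 : 0 ≤ (2 * A - a * V) ^ 2 / V ^ 2 := by positivity
  have h4 : 2 / V * (A ^ 2 / V - 2 * a * A + a ^ 2 * V) + 2 / V ^ 2 * A ^ 2 - a ^ 2 =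
      (2 * A - a * V) ^ 2 / V ^ 2 := by
    field_simp
    ring
  have h5 : 2 / V * (A ^ 2 / V - 2 * a * A + a ^ 2 * V) ≤
      2 / V * (F - 2 * a * A + a ^ 2 * V) := by gcongr
  linarith

theorem lintegral_cell_sq_le {f : EuclideanSpace ℝ (Fin n) → ℝ} (hf : ContDiff ℝ ∞ f)
    (hc : HasCompactSupport f) {s : ℝ} (hs : 0 < s) (j : Fin n → ℤ) :
    ∫⁻ x in cell s j, ENNReal.ofReal (f x ^ 2) ≤
      ENNReal.ofReal (2 / s ^ n) *
        (∫⁻ x in cell s j, ∫⁻ y in cell s j, ENNReal.ofReal ((f y - f x) ^ 2)) +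
      ENNReal.ofReal (2 / s ^ n * (∫ y in cell s j, f y) ^ 2) := by
  have hfc := hf.continuous
  have : IsFiniteMeasure (volume.restrict (cell s j)) := by
    refine isFiniteMeasure_restrict.2 ?_
    rw [volume_cell]
    exact ENNReal.pow_ne_top ENNReal.ofReal_ne_top
  have hpt : ∀ x, ENNReal.ofReal (f x ^ 2) ≤ ENNReal.ofReal (2 / s ^ n) *
      (∫⁻ y in cell s j, ENNReal.ofReal ((f y - f x) ^ 2)) +
      ENNReal.ofReal (2 / (s ^ n) ^ 2 * (∫ y in cell s j, f y) ^ 2) := by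
    intro x
    have hint : Integrable (fun y => (f y - f x) ^ 2) (volume.restrict (cell s j)) := by
      have h1 : MemLp f 2 (volume.restrict (cell s j)) := hfc.memLp_of_hasCompactSupport hc
      exact (h1.sub (memLp_const (f x))).integrable_sq
    rw [← ofReal_integral_eq_lintegral_ofReal hint (Eventually.of_forall fun _ => sq_nonneg _),
      ← ENNReal.ofReal_mul (by positivity), ← ENNReal.ofReal_add (by positivity) (by positivity)]
    exact ENNReal.ofReal_le_ofReal (sq_le_cell hf hc hs j (f x))
  refine (lintegral_mono hpt).trans ?_
  have hmeas : Measurable fun x => ∫⁻ y in cell s j, ENNReal.ofReal ((f y - f x) ^ 2) := by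
    refine Measurable.lintegral_prod_right' (f := fun z : EuclideanSpace ℝ (Fin n) ×
      EuclideanSpace ℝ (Fin n) => ENNReal.ofReal ((f z.2 - f z.1) ^ 2)) ?_
    exact ENNReal.measurable_ofReal.comp (Continuous.measurable (by fun_prop))
  rw [lintegral_add_right _ measurable_const, lintegral_const_mul _ hmeas, setLIntegral_const,
    volume_cell, ← ENNReal.ofReal_pow hs.le, ← ENNReal.ofReal_mul (by positivity)]
  refine le_of_eq ?_
  congr 2
  field_simp

/-- A quantitative form of Rellich's theorem: the `L²` norm is controlled by a small multiple of
the gradient and finitely many means over cells. -/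
theorem integral_sq_le_cells {f : EuclideanSpace ℝ (Fin n) → ℝ} (hf : ContDiff ℝ ∞ f)
    (hc : HasCompactSupport f) {s : ℝ} (hs : 0 < s) {J : Finset (Fin n → ℤ)}
    (hJ : ∀ x, f x ≠ 0 → ∃ j ∈ J, x ∈ cell s j) :
    ∫ x, f x ^ 2 ≤ 2 * 2 ^ n * n * s ^ 2 * (∫ x, gradSq f x) +
      ∑ j ∈ J, 2 / s ^ n * (∫ y in cell s j, f y) ^ 2 := by
  have hfc := hf.continuous
  have hg0 : 0 ≤ ∫ x, gradSq f x := integral_nonneg fun x => gradSq_nonneg f x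
  have hgi : Integrable (gradSq f) := by
    refine integrable_finsetSum _ fun p _ => ?_
    refine ((contDiff_pderiv p hf).continuous.pow 2).integrable_of_hasCompactSupport ?_
    simpa only [sq] using (hasCompactSupport_pderiv p hc).mul_right
  have hfi : Integrable fun x => f x ^ 2 :=
    (hfc.pow 2).integrable_of_hasCompactSupport (by simpa only [sq] using hc.mul_right)
  have hsum0 : 0 ≤ ∑ j ∈ J, 2 / s ^ n * (∫ y in cell s j, f y) ^ 2 :=
    Finset.sum_nonneg fun j _ => by positivity
  rw [← ENNReal.ofReal_le_ofReal_iff (by positivity),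
    ofReal_integral_eq_lintegral_ofReal hfi (Eventually.of_forall fun _ => sq_nonneg _)]
  have hunion : ∫⁻ x, ENNReal.ofReal (f x ^ 2) =
      ∑ j ∈ J, ∫⁻ x in cell s j, ENNReal.ofReal (f x ^ 2) := by
    rw [← lintegral_biUnion_finset (fun i _ j _ hij => disjoint_cell hs hij)
      fun j _ => measurableSet_cell s j,
      ← lintegral_indicator (Finset.measurableSet_biUnion J fun j _ => measurableSet_cell s j)]
    refine lintegral_congr fun x => ?_
    symm
    rw [Set.indicator_apply_eq_self]
    intro hx
    by_contra h0
    obtain ⟨j, hj, hxj⟩ := hJ x fun h => h0 (by rw [h]; simp)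
    exact hx (Set.mem_biUnion hj hxj)
  rw [hunion]
  calc ∑ j ∈ J, ∫⁻ x in cell s j, ENNReal.ofReal (f x ^ 2)
      ≤ ∑ j ∈ J, (ENNReal.ofReal (2 / s ^ n) *
          (∫⁻ x in cell s j, ∫⁻ y in cell s j, ENNReal.ofReal ((f y - f x) ^ 2)) +
          ENNReal.ofReal (2 / s ^ n * (∫ y in cell s j, f y) ^ 2)) :=
        Finset.sum_le_sum fun j _ => lintegral_cell_sq_le hf hc hs j
    _ = ENNReal.ofReal (2 / s ^ n) * (∑ j ∈ J, ∫⁻ x in cell s j, ∫⁻ y in cell s j,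
          ENNReal.ofReal ((f y - f x) ^ 2)) +
          ENNReal.ofReal (∑ j ∈ J, 2 / s ^ n * (∫ y in cell s j, f y) ^ 2) := by
        rw [Finset.sum_add_distrib, ← Finset.mul_sum,
          ENNReal.ofReal_sum_of_nonneg fun j _ => by positivity]
    _ ≤ ENNReal.ofReal (2 / s ^ n) * (ENNReal.ofReal ((2 * s) ^ n * (n * s ^ 2)) *
          ∫⁻ x, ENNReal.ofReal (gradSq f x)) +
          ENNReal.ofReal (∑ j ∈ J, 2 / s ^ n * (∫ y in cell s j, f y) ^ 2) := by
        gcongr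
        exact sum_lintegral_cell_le hf hs J
    _ = _ := by
        rw [← ofReal_integral_eq_lintegral_ofReal hgi (Eventually.of_forall (gradSq_nonneg f)),
          ← ENNReal.ofReal_mul (by positivity), ← ENNReal.ofReal_mul (by positivity),
          ← ENNReal.ofReal_add (by positivity) hsum0]
        congr 2
        rw [mul_pow]
        field_simp

end CellEstimate

/-! ### Compactness of the embedding -/

section Rellich

variable {n : ℕ} {Ω : TopologicalSpace.Opens (EuclideanSpace ℝ (Fin n))}

theorem integral_gradSq (φ : 𝓓(Ω, ℝ)) :
    ∫ x, gradSq φ x = ∑ p, ‖toL2 (testDeriv p φ)‖ ^ 2 := by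
  simp only [gradSq, norm_toL2_sq, testDeriv_coe]
  refine integral_finsetSum _ fun p _ => ?_
  refine ((contDiff_pderiv p φ.contDiff).continuous.pow 2).integrable_of_hasCompactSupport ?_
  simpa only [sq] using (hasCompactSupport_pderiv p φ.hasCompactSupport).mul_right

theorem restrict_cell_ne_top (s : ℝ) (j : Fin n → ℤ) :
    volume.restrict (Ω : Set (EuclideanSpace ℝ (Fin n))) (cell s j) ≠ ⊤ := by
  refine ne_top_of_le_ne_top ?_ (Measure.restrict_apply_le _ _)
  rw [volume_cell]
  exact ENNReal.pow_ne_top ENNReal.ofReal_ne_top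

/-- The indicator function of a cell. -/
noncomputable def cellInd (Ω : TopologicalSpace.Opens (EuclideanSpace ℝ (Fin n))) (s : ℝ)
    (j : Fin n → ℤ) : L2 Ω :=
  indicatorConstLp 2 (measurableSet_cell s j) (restrict_cell_ne_top s j) (1 : ℝ)

theorem inner_cellInd_toL2 (s : ℝ) (j : Fin n → ℤ) (φ : 𝓓(Ω, ℝ)) :
    ⟪cellInd Ω s j, toL2 φ⟫_ℝ = ∫ y in cell s j, φ y := by
  rw [cellInd, L2.inner_indicatorConstLp_one]
  have h1 : ∫ y in cell s j, toL2 φ y ∂(volume.restrict (Ω : Set (EuclideanSpace ℝ (Fin n)))) =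
      ∫ y in cell s j, φ y ∂(volume.restrict (Ω : Set (EuclideanSpace ℝ (Fin n)))) :=
    integral_congr_ae (ae_restrict_of_ae (coeFn_toL2 φ))
  rw [h1, Measure.restrict_restrict (measurableSet_cell s j)]
  refine (setIntegral_eq_of_subset_of_forall_sdiff_eq_zero (measurableSet_cell s j)
    Set.inter_subset_left fun x hx => ?_).symm
  exact image_eq_zero_of_notMem_tsupport fun h => hx.2 ⟨hx.1, φ.tsupport_subset h⟩

/-- Rellich's theorem: the embedding of `H²₀(Ω)` into `L²(Ω)` is compact. -/
theorem isCompactOperator_energyEmb (hn : 1 ≤ n)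
    (hbdd : Bornology.IsBounded (Ω : Set (EuclideanSpace ℝ (Fin n)))) :
    IsCompactOperator (energyEmb Ω) := by
  refine isCompactOperator_of_finiteRank_estimate _ fun ε hε => ?_
  obtain ⟨R, -, hR⟩ := exists_norm_bound hbdd
  set D := ∑ p, ‖energyDeriv Ω p‖ ^ 2
  have hD : 0 ≤ D := Finset.sum_nonneg fun p _ => sq_nonneg _
  obtain ⟨s, hs, hsε⟩ : ∃ s : ℝ, 0 < s ∧ 2 * 2 ^ n * n * s ^ 2 * D ≤ ε := by
    -- The `+ 1` keeps `C` positive even when `D = 0`; then `s² = ε / C`.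
    set C := 2 * 2 ^ n * n * D + 1
    have hC : 0 < C := by positivity
    refine ⟨√(ε / C), by positivity, ?_⟩
    rw [Real.sq_sqrt (by positivity)]
    have h1 : 2 * 2 ^ n * n * (ε / C) * D = (C - 1) * (ε / C) := by ring
    have h2 : C * (ε / C) = ε := mul_div_cancel₀ _ hC.ne'
    have h3 : 0 < ε / C := by positivity
    linarith
  let J : Finset (Fin n → ℤ) := Fintype.piFinset fun _ => Finset.Icc ⌊-R / s⌋ ⌊R / s⌋
  have hJ : ∀ x ∈ (Ω : Set (EuclideanSpace ℝ (Fin n))), ∃ j ∈ J, x ∈ cell s j := by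
    intro x hx
    refine ⟨fun p => ⌊x p / s⌋, ?_, mem_cell_floor hs x⟩
    rw [Fintype.mem_piFinset]
    intro p
    have h := abs_le.1 ((PiLp.norm_apply_le x p).trans (hR x hx))
    rw [Finset.mem_Icc]
    constructor
    · exact Int.floor_le_floor (div_le_div_of_nonneg_right h.1 hs.le)
    · exact Int.floor_le_floor (div_le_div_of_nonneg_right h.2 hs.le)
  have hmain : ∀ g : Energy Ω, ‖energyEmb Ω g‖ ^ 2 ≤
      2 * 2 ^ n * n * s ^ 2 * (∑ p, ‖energyDeriv Ω p g‖ ^ 2) +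
        ∑ j ∈ J, 2 / s ^ n * ⟪cellInd Ω s j, energyEmb Ω g⟫_ℝ ^ 2 := by
    refine energy_induction (isClosed_le (by fun_prop) (by fun_prop)) fun φ => ?_
    simp only [energyEmb_toEnergy hn hbdd, energyDeriv_toEnergy hbdd, inner_cellInd_toL2,
      ← integral_gradSq]
    rw [norm_toL2_sq]
    refine integral_sq_le_cells φ.contDiff φ.hasCompactSupport hs fun x hx => hJ x ?_
    exact φ.tsupport_subset (subset_tsupport _ hx)
  -- The finite-rank map lists the cell integrals, weighted by `√(2 / s ^ n)` so that its squared
  -- norm is the sum in `hmain`.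
  refine ⟨J, inferInstance,
    (PiLp.continuousLinearEquiv 2 ℝ fun _ : J => ℝ).symm.toContinuousLinearMap ∘L
    ContinuousLinearMap.pi fun j : J =>
      √(2 / s ^ n) • (innerSL ℝ (cellInd Ω s j) ∘L energyEmb Ω), fun g => ?_⟩
  refine (hmain g).trans (add_le_add ?_ (le_of_eq ?_))
  · have h1 : ∑ p, ‖energyDeriv Ω p g‖ ^ 2 ≤ D * ‖g‖ ^ 2 := by
      rw [Finset.sum_mul]
      refine Finset.sum_le_sum fun p _ => ?_
      rw [← mul_pow]
      gcongr
      exact (energyDeriv Ω p).le_opNorm g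
    calc 2 * 2 ^ n * n * s ^ 2 * (∑ p, ‖energyDeriv Ω p g‖ ^ 2)
        ≤ 2 * 2 ^ n * n * s ^ 2 * (D * ‖g‖ ^ 2) := by gcongr
      _ = 2 * 2 ^ n * n * s ^ 2 * D * ‖g‖ ^ 2 := by ring
      _ ≤ ε * ‖g‖ ^ 2 := by gcongr
  · rw [EuclideanSpace.norm_sq_eq, ← Finset.sum_coe_sort]
    refine Finset.sum_congr rfl fun j _ => ?_
    change _ = ‖√(2 / s ^ n) * ⟪cellInd Ω s j, energyEmb Ω g⟫_ℝ‖ ^ 2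
    rw [Real.norm_eq_abs, sq_abs, mul_pow, Real.sq_sqrt (by positivity)]

end Rellich

/-! ### The solution operator and the final inequality -/

section Main

variable {n : ℕ} {Ω : TopologicalSpace.Opens (EuclideanSpace ℝ (Fin n))}

/-- Bump functions supported in pairwise disjoint open subsets of `Ω` are nonzero and mutually
orthogonal. -/
theorem exists_linearIndependent_testFunctions (hn : 1 ≤ n)
    (hΩ : (Ω : Set (EuclideanSpace ℝ (Fin n))).Nonempty) :
    ∃ φ : ℕ → 𝓓(Ω, ℝ), LinearIndependent ℝ fun k => toL2 (φ k) := by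
  have : Nonempty (Fin n) := ⟨⟨0, hn⟩⟩
  obtain ⟨x₀, hx₀⟩ := hΩ
  have : (𝓝[≠] x₀).NeBot := Module.punctured_nhds_neBot ℝ _ x₀
  have : Infinite Ω :=
    (infinite_of_mem_nhds x₀ (Ω.isOpen.mem_nhds hx₀)).to_subtype
  obtain ⟨U, hUinf, hUo, hUd⟩ := exists_seq_infinite_isOpen_pairwise_disjoint Ω
  have hex : ∀ k, ∃ φ : 𝓓(Ω, ℝ), tsupport φ ⊆ Subtype.val '' U k ∧
      ∃ x, φ x ≠ 0 := by
    intro k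
    obtain ⟨x, hx⟩ := (hUinf k).nonempty
    have hopen : IsOpen (Subtype.val '' U k : Set (EuclideanSpace ℝ (Fin n))) :=
      Ω.isOpen.isOpenMap_subtype_val _ (hUo k)
    obtain ⟨f, hfs, hfc, hf, -, hfx⟩ := exists_contDiff_tsupport_subset (n := ⊤)
      (hopen.mem_nhds ⟨x, hx, rfl⟩)
    refine ⟨⟨f, hf, hfc, hfs.trans (Subtype.coe_image_subset _ _)⟩, hfs, x, ?_⟩
    change f x ≠ 0
    rw [hfx]
    exact one_ne_zero
  choose φ hsupp hne using hex
  refine ⟨φ, linearIndependent_of_ne_zero_of_inner_eq_zero (𝕜 := ℝ) (fun k h0 => ?_)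
    fun i j hij => ?_⟩
  · have h1 := norm_toL2_sq (φ k)
    rw [h0, norm_zero, zero_pow two_ne_zero] at h1
    have hc : HasCompactSupport fun x => φ k x ^ 2 :=
      (φ k).hasCompactSupport.comp_left (g := fun t : ℝ => t ^ 2) (zero_pow two_ne_zero)
    obtain ⟨x, hx⟩ := hne k
    exact (((φ k).continuous.pow 2).integral_pos_of_hasCompactSupport_nonneg_nonzero hc
      (fun x => sq_nonneg _) (pow_ne_zero 2 hx)).ne h1
  · change ⟪toL2 (φ i), toL2 (φ j)⟫_ℝ = 0
    rw [inner_toL2_toL2]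
    refine integral_eq_zero_of_ae (Eventually.of_forall fun x => ?_)
    by_contra h0
    obtain ⟨hi, hj⟩ := mul_ne_zero_iff.1 h0
    have hdisj := (Set.disjoint_image_iff Subtype.val_injective).2 (hUd hij)
    exact Set.disjoint_left.1 hdisj (hsupp i (subset_tsupport _ hi))
      (hsupp j (subset_tsupport _ hj))

open ContinuousLinearMap (adjoint adjoint_inner_left adjoint_inner_right)

/-- The inverse of the clamped biharmonic operator. -/
noncomputable def solutionOperator (Ω : TopologicalSpace.Opens (EuclideanSpace ℝ (Fin n))) :
    L2 Ω →L[ℝ] L2 Ω :=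
  energyEmb Ω ∘L adjoint (energyEmb Ω)

theorem inner_solutionOperator (x y : L2 Ω) : ⟪solutionOperator Ω x, y⟫_ℝ =
    ⟪adjoint (energyEmb Ω) x, adjoint (energyEmb Ω) y⟫_ℝ :=
  (adjoint_inner_right (energyEmb Ω) (adjoint (energyEmb Ω) x) y).symm

theorem isSymmetric_solutionOperator :
    (solutionOperator Ω : L2 Ω →ₗ[ℝ] L2 Ω).IsSymmetric := by
  intro x y
  change ⟪solutionOperator Ω x, y⟫_ℝ = ⟪x, solutionOperator Ω y⟫_ℝ
  rw [inner_solutionOperator, real_inner_comm (solutionOperator Ω y), inner_solutionOperator,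
    real_inner_comm]

theorem inner_solutionOperator_self (x : L2 Ω) :
    ⟪solutionOperator Ω x, x⟫_ℝ = ‖adjoint (energyEmb Ω) x‖ ^ 2 := by
  rw [inner_solutionOperator, real_inner_self_eq_norm_sq]

/-- If `z` is orthogonal to the range of `T`, then `‖S* z‖² = ⟪T z, z⟫ = 0`, so `z` is orthogonal to
every test function. A finite-dimensional range would therefore contain all test functions. -/
theorem range_solutionOperator_infinite (hn : 1 ≤ n)
    (hΩ : (Ω : Set (EuclideanSpace ℝ (Fin n))).Nonempty)
    (hbdd : Bornology.IsBounded (Ω : Set (EuclideanSpace ℝ (Fin n)))) :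
    ¬ FiniteDimensional ℝ (LinearMap.range (solutionOperator Ω : L2 Ω →ₗ[ℝ] L2 Ω)) := by
  intro hfd
  set V := LinearMap.range (solutionOperator Ω : L2 Ω →ₗ[ℝ] L2 Ω)
  have hmem : ∀ φ : 𝓓(Ω, ℝ), toL2 φ ∈ V := by
    intro φ
    set y := toL2 φ
    set z := y - V.starProjection y with hz
    have hzV : z ∈ Vᗮ := V.sub_starProjection_mem_orthogonal y
    have h1 : adjoint (energyEmb Ω) z = 0 := by
      have h2 := (Submodule.mem_orthogonal _ _).1 hzV _ (LinearMap.mem_range_self _ z)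
      change ⟪solutionOperator Ω z, z⟫_ℝ = 0 at h2
      rw [inner_solutionOperator_self] at h2
      exact norm_eq_zero.1 (pow_eq_zero_iff two_ne_zero |>.1 h2)
    have h3 : ⟪z, y⟫_ℝ = 0 := by
      rw [show y = energyEmb Ω (toEnergy φ) from (energyEmb_toEnergy hn hbdd φ).symm,
        ← adjoint_inner_left, h1, inner_zero_left]
    have h4 : ⟪z, V.starProjection y⟫_ℝ = 0 :=
      (Submodule.mem_orthogonal' _ _).1 hzV _ (V.starProjection_apply_mem y)
    have h5 : z = 0 := by
      rw [← inner_self_eq_zero (𝕜 := ℝ)]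
      nth_rw 2 [hz]
      rw [inner_sub_right, h3, h4, sub_zero]
    rw [sub_eq_zero.1 h5]
    exact V.starProjection_apply_mem y
  obtain ⟨φ, hφ⟩ := exists_linearIndependent_testFunctions hn hΩ
  have hli : LinearIndependent ℝ fun k => (⟨toL2 (φ k), hmem (φ k)⟩ : V) :=
    LinearIndependent.of_comp V.subtype hφ
  exact not_finite_iff_infinite.2 inferInstance hli.finite

theorem eigenvalue_inequality (hn : 1 ≤ n)
    (hbdd : Bornology.IsBounded (Ω : Set (EuclideanSpace ℝ (Fin n)))) {m : ℕ} (hm : 1 ≤ m)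
    (hpos : ∀ k, 1 ≤ k → 0 < eigenvalue Ω k)
    (hmono : ∀ k l, 1 ≤ k → k ≤ l → eigenvalue Ω k ≤ eigenvalue Ω l)
    (hlt : eigenvalue Ω m < eigenvalue Ω (m + 1)) {w : Fin m → L2 Ω} (hw : Orthonormal ℝ w)
    (hwe : ∀ i : Fin m, w i ∈ eigenspace Ω (eigenvalue Ω (i + 1)))
    (hray : ∀ x, (∀ i, ⟪w i, x⟫_ℝ = 0) →
      eigenvalue Ω (m + 1) * ⟪solutionOperator Ω x, x⟫_ℝ ≤ ‖x‖ ^ 2) :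
    (n : ℝ) ^ 2 * m / (8 * (n + 2)) ≤ ∑ i : Fin m,
      eigenvalue Ω (i + 1) / (eigenvalue Ω (m + 1) - eigenvalue Ω (i + 1)) := by
  set S := energyEmb Ω with hS
  -- The energy representatives of the eigenfunctions: `S u_i = Γ_i T w_i = w_i`.
  set u : Fin m → Energy Ω := fun i => eigenvalue Ω (i + 1) • adjoint S (w i) with hu
  have hSu : ∀ i, S (u i) = w i := fun i => by
    rw [hu, map_smul]
    exact ((mem_eigenspace_iff hn hbdd _ _).1 (hwe i)).symm
  refine sum_div_sub_ge (u := u) (Γ := fun i : Fin m => eigenvalue Ω (i + 1)) hn hbdd hm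
    (fun i => hpos _ (Nat.le_add_left 1 i))
    (fun i j hij => hmono _ _ (Nat.le_add_left 1 i) (Nat.succ_le_succ hij))
    (fun i => (hmono _ _ (Nat.le_add_left 1 i) i.2).trans_lt hlt) (fun i v => ?_) ?_
    fun v hv => ?_
  · rw [← hS, hSu, ← adjoint_inner_left]
    exact real_inner_smul_left (adjoint S (w i)) v _
  · simpa only [← hS, hSu] using hw
  · simp only [← hS, hSu] at hv
    have h1 := hray _ hv
    rw [inner_solutionOperator_self, ← hS] at h1
    rcases (sq_nonneg ‖S v‖).eq_or_lt with h0 | h0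
    · rw [← hS, ← h0, mul_zero]
      positivity
    -- Passing from the bound for `T` on `L²(Ω)` to the Rayleigh bound: `‖S v‖² = ⟪S* S v, v⟫`, and
    -- `hray` at `x = S v` controls `‖S* S v‖²`.
    have h2 : ‖S v‖ ^ 2 ≤ ‖adjoint S (S v)‖ * ‖v‖ := by
      rw [← real_inner_self_eq_norm_sq, ← adjoint_inner_left]
      exact real_inner_le_norm _ _
    have h3 : (‖S v‖ ^ 2) ^ 2 ≤ ‖adjoint S (S v)‖ ^ 2 * ‖v‖ ^ 2 := by
      rw [← mul_pow]
      gcongr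
    refine le_of_mul_le_mul_left ?_ h0
    have hG := (hpos (m + 1) (Nat.le_add_left 1 m)).le
    calc ‖S v‖ ^ 2 * (eigenvalue Ω (m + 1) * ‖S v‖ ^ 2)
        = eigenvalue Ω (m + 1) * (‖S v‖ ^ 2) ^ 2 := by ring
      _ ≤ eigenvalue Ω (m + 1) * (‖adjoint S (S v)‖ ^ 2 * ‖v‖ ^ 2) := by gcongr
      _ = eigenvalue Ω (m + 1) * ‖adjoint S (S v)‖ ^ 2 * ‖v‖ ^ 2 := by ring
      _ ≤ ‖S v‖ ^ 2 * ‖v‖ ^ 2 := by gcongr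

end Main

end ClampedPlate

/-- The clamped plate eigenvalues of a bounded domain `Ω ⊂ ℝⁿ` satisfy
`∑_{i=1}^m Γ_i / (Γ_{m+1} - Γ_i) ≥ n² m / (8 (n + 2))` for every `m`. The sum is taken in
`[0, ∞]`, so that a term with `Γ_i = Γ_{m+1}` (where `Γ_i > 0`) has the value `+∞`. -/
theorem mainTheorem5 {n : ℕ} (hn : 1 ≤ n)
    (Ω : TopologicalSpace.Opens (EuclideanSpace ℝ (Fin n)))
    (hconn : IsConnected (Ω : Set (EuclideanSpace ℝ (Fin n))))
    (hbdd : Bornology.IsBounded (Ω : Set (EuclideanSpace ℝ (Fin n))))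
    (m : ℕ) (hm : 1 ≤ m) :
    ENNReal.ofReal ((n : ℝ) ^ 2 * m / (8 * (n + 2))) ≤
      ∑ i ∈ Finset.Icc 1 m,
        ENNReal.ofReal (ClampedPlate.eigenvalue Ω i) /
          ENNReal.ofReal (ClampedPlate.eigenvalue Ω (m + 1) - ClampedPlate.eigenvalue Ω i) := by
  have hE : ∀ Γ w, w ∈ ClampedPlate.eigenspace Ω Γ ↔
      w = Γ • ClampedPlate.solutionOperator Ω w := fun Γ w =>
    ClampedPlate.mem_eigenspace_iff hn hbdd Γ w
  have hsymm := ClampedPlate.isSymmetric_solutionOperator (Ω := Ω)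
  have hcomp : IsCompactOperator (ClampedPlate.solutionOperator Ω) :=
    (ClampedPlate.isCompactOperator_energyEmb hn hbdd).comp_clm _
  have hnonneg : ∀ x, 0 ≤ inner ℝ (ClampedPlate.solutionOperator Ω x) x := fun x => by
    rw [ClampedPlate.inner_solutionOperator_self]
    positivity
  have hinf := ClampedPlate.range_solutionOperator_infinite hn hconn.nonempty hbdd
  have hpos : ∀ k, 1 ≤ k → 0 < ClampedPlate.eigenvalue Ω k := fun k hk =>
    ClampedPlate.countingValue_pos hE hsymm hcomp hnonneg hinf hk
  have hmono : ∀ k l, 1 ≤ k → k ≤ l →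
      ClampedPlate.eigenvalue Ω k ≤ ClampedPlate.eigenvalue Ω l := fun k l hk hkl =>
    ClampedPlate.countingValue_le hE hsymm hcomp hnonneg hinf hk hkl
  rcases ClampedPlate.countingValue_dichotomy hE hsymm hcomp hnonneg hinf hm with
    heq | ⟨hlt, w, hw, hwe, hray⟩
  · change ClampedPlate.eigenvalue Ω m = ClampedPlate.eigenvalue Ω (m + 1) at heq
    -- The term `i = m` alone is infinite: its denominator is 0 and its numerator is positive.
    refine le_trans ?_ (Finset.single_le_sum (fun i _ => zero_le) (Finset.mem_Icc.2 ⟨hm, le_rfl⟩))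
    rw [heq, sub_self, ENNReal.ofReal_zero, ENNReal.div_zero]
    · exact le_top
    · exact (ENNReal.ofReal_pos.2 (hpos _ (Nat.le_add_left 1 m))).ne'
  · change ClampedPlate.eigenvalue Ω m < ClampedPlate.eigenvalue Ω (m + 1) at hlt
    have hden : ∀ i : Fin m, 0 < ClampedPlate.eigenvalue Ω (m + 1) -
        ClampedPlate.eigenvalue Ω (i + 1) := fun i =>
      sub_pos.2 ((hmono _ _ (Nat.le_add_left 1 i) i.2).trans_lt hlt)
    refine (ENNReal.ofReal_le_ofReal
      (ClampedPlate.eigenvalue_inequality hn hbdd hm hpos hmono hlt hw hwe hray)).trans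
      (le_of_eq ?_)
    -- All denominators are positive, so the real sum transfers termwise; the index shifts from `0,
    -- …, m - 1` to `1, …, m`.
    rw [ENNReal.ofReal_sum_of_nonneg fun (i : Fin m) _ =>
      div_nonneg (hpos _ (Nat.le_add_left 1 i)).le (hden i).le, ← Finset.Ico_add_one_right_eq_Icc,
      Finset.sum_Ico_eq_sum_range, Nat.add_sub_cancel, Finset.sum_range]
    refine Finset.sum_congr rfl fun i _ => ?_
    rw [ENNReal.ofReal_div_of_pos (hden i), add_comm 1 (i : ℕ)]
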